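/- Let $\mathbb{F}_b$ be a finite field with $b$ elements and let $\phi:\{0,1,\dots,b-1\}\to\mathbb{F}_b$ be a bijection with $\phi(0)=0$. Let $p_1,\dots,p_s\in\mathbb{F}_b[x]$ be pairwise coprime polynomials of degrees $e_i=\deg p_i\ge 1$ with $(x,p_i)=1$ for $1\le i\le s$. For $1\le i\le s$, $j\ge 1$ and $0\le k<e_i$ let $y_{i,j,k}\in\mathbb{F}_b[x]$ be polynomials such that, for all $i$ and $j$, the polynomials $y_{i,j,k}$, $0\le k<e_i$, are linearly independent over $\mathbb{F}_b$ modulo $p_i$. For $r\ge 0$ let $a^{(i)}(j,k,r)$ be the coefficient of $x^{-r-1}$ in the expansion of $y_{i,j,k}(x)/p_i(x)^j$ in the field $\mathbb{F}_b((x^{-1}))$ of formal Laurent series, and put $$c^{(i)}_{j,r}=a^{(i)}(Q+1,k,r)\qquad (1\le i\le s,\ j\ge 1,\ r\ge 0),$$ where $j-1=Qe_i+k$ with integers $Q$ and $k$, $0\le k<e_i$. For an integer $n\ge 0$ with $b$-adic expansion $n=\sum_{r\ge 0}a_r(n)b^r$ let $$x_n^{(i)}=\sum_{j\ge 1}\phi^{-1}\Big(\sum_{r\ge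 0}\phi(a_r(n))\,c^{(i)}_{j,r}\Big)b^{-j},\qquad \mathbf{x}_n=(x_n^{(1)},\dots,x_n^{(s)});$$ the sequence $(\mathbf{x}_n)_{n\ge 0}$ is the generalized (Tezuka) Niederreiter sequence, that is, the digital sequence over $\mathbb{F}_b$ generated by the matrices $(c^{(i)}_{j,r})_{j\ge 1,\,r\ge 0}$. Theorem 1. Let $\gamma_1,\dots,\gamma_s\in(0,1)$ have the (standard) $b$-adic expansions $\gamma_i=\sum_{j\ge 1}\gamma_{i,j}b^{-j}$, $\gamma_{i,j}=\lfloor b^j\gamma_i\rfloor \bmod b$. Then the box $S=[0,\gamma_1)\times\cdots\times[0,\gamma_s)$ is a bounded remainder set for $(\mathbf{x}_n)_{n\ge 0}$, i.e. the sums $\sum_{n=0}^{N-1}\big(\mathbf{1}_S(\mathbf{x}_n)-\gamma_1\cdots\gamma_s\big)$ are bounded uniformly in $N$, if and only if $$\max_{1\le i\le s}\max\{j\ge 1 : \gamma_{i,j}\ne 0\}<\infty .$$ -/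

import Mathlib

/-- The discrepancy function `Δ(S, (x_n)_{n < N}) = ∑_{n < N} (1_S(x_n) - λ(S))` of a set `S` with
respect to a sequence of points of `ℝ^s`; `λ` is the `s`-dimensional Lebesgue measure. -/
noncomputable def discrepancyFunction {s : ℕ} (S : Set (Fin s → ℝ)) (x : ℕ → Fin s → ℝ)
    (N : ℕ) : ℝ :=
  ∑ n ∈ Finset.range N,
    (S.indicator (fun _ => (1 : ℝ)) (x n) - (MeasureTheory.volume : MeasureTheory.Measure _).real S)

/-- `S` is a bounded remainder set for the sequence `x`: the discrepancy function is bounded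
in `N`. -/
def IsBoundedRemainderSet {s : ℕ} (S : Set (Fin s → ℝ)) (x : ℕ → Fin s → ℝ) : Prop :=
  ∃ K : ℝ, ∀ N : ℕ, |discrepancyFunction S x N| ≤ K

/-- The box `[0, γ_1) × ... × [0, γ_s)`. -/
def anchoredBox {s : ℕ} (γ : Fin s → ℝ) : Set (Fin s → ℝ) :=
  Set.univ.pi fun i => Set.Ico 0 (γ i)

/-- All `γ_i` have a finite `b`-adic expansion: the positions of the nonzero `b`-adic digits of
all the `γ_i` are bounded, that is `max_i max {j | γ_{i,j} ≠ 0} < ∞`. Here `Real.digits (γ i) b j`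
is the digit of `γ_i` that belongs to `b^{-(j+1)}` (in the standard expansion, which is the finite
one whenever there is a finite one). -/
def HasFiniteExpansions {s : ℕ} (b : ℕ) [NeZero b] (γ : Fin s → ℝ) : Prop :=
  BddAbove {j : ℕ | ∃ i : Fin s, Real.digits (γ i) b j ≠ 0}

/-- The digit `a_r(n)` of the `b`-adic expansion `n = ∑_r a_r(n) b^r`. -/
def natDigit (b : ℕ) [NeZero b] (n r : ℕ) : Fin b :=
  Fin.ofNat b (n / b ^ r)

/-- The digital sequence over the field `F` with `b` elements that is generated by the infinite
matrices `C^(1), ..., C^(s)` with the help of the bijection `φ` from the digits `{0, ..., b-1}`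
to `F`. The rows of the matrices are numbered from `0`: `C i j r` is the entry of `C^(i)` in its
`(j+1)`-st row and in the column that belongs to the digit `a_r(n)`. The sum over `r` runs over
all digits of `n`; further terms would vanish when `φ 0 = 0`. -/
noncomputable def digitalSequence {F : Type*} [Field F] {s : ℕ} (b : ℕ) [NeZero b] (φ : Fin b ≃ F)
    (C : Fin s → ℕ → ℕ → F) (n : ℕ) : Fin s → ℝ :=
  fun i => Real.ofDigits fun j : ℕ =>
    φ.symm (∑ r ∈ Finset.range (Nat.digits b n).length, φ (natDigit b n r) * C i j r)

/-- The ring homomorphism from `F[x]` to the field `F((x⁻¹))` of formal Laurent series in `x⁻¹`.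
The variable of `LaurentSeries F` plays the role of `x⁻¹`, so that `x` goes to its inverse. -/
noncomputable def toLaurentAtInfinity (F : Type*) [Field F] :
    Polynomial F →+* LaurentSeries F :=
  Polynomial.eval₂RingHom (HahnSeries.C : F →+* LaurentSeries F) (HahnSeries.single (-1 : ℤ) 1)

/-- The coefficient of `x^{-r-1}` in the expansion of `y / q` in `F((x⁻¹))`. -/
noncomputable def expansionCoeff {F : Type*} [Field F] (y q : Polynomial F) (r : ℕ) : F :=
  (toLaurentAtInfinity F y / toLaurentAtInfinity F q).coeff ((r : ℤ) + 1)

/-- The generating matrices of the generalized Niederreiter sequence. If the row index `j`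
(numbered from `0`) is `j = Q e_i + k` with `0 ≤ k < e_i = deg p_i`, then the entry in column `r`
is the coefficient of `x^{-r-1}` in `y_{i,Q+1,k} / p_i^{Q+1}`. -/
noncomputable def niederreiterMatrix {F : Type*} [Field F] {s : ℕ} (p : Fin s → Polynomial F)
    (y : Fin s → ℕ → ℕ → Polynomial F) (i : Fin s) (j r : ℕ) : F :=
  expansionCoeff (y i (j / (p i).natDegree + 1) (j % (p i).natDegree))
    (p i ^ (j / (p i).natDegree + 1)) r

/-- The generalized Niederreiter sequence with the base polynomials `p_i` and the numerator
polynomials `y_{i,j,k}` (`j ≥ 1`, `0 ≤ k < deg p_i`). -/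
noncomputable def generalizedNiederreiterSequence {F : Type*} [Field F] {s : ℕ} (b : ℕ) [NeZero b]
    (φ : Fin b ≃ F) (p : Fin s → Polynomial F) (y : Fin s → ℕ → ℕ → Polynomial F) :
    ℕ → Fin s → ℝ :=
  digitalSequence b φ (niederreiterMatrix p y)

/-! An index n becomes a polynomial f over F via its digits, and digit j of coordinate i becomes a
linear functional of f, the residue pairing with y/p_i^(Q+1). The first e_i m digits in coordinate i
vanish exactly when p_i^m divides f (`pow_dvd_iff_digitFunctional_eq_zero`). By the Chinese
remainder theorem, multiplying f by a polynomial prime to all p_i and adding a constant still makes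
the leading digits run once through every combination while f runs through the polynomials of degree
below m(e_1+...+e_s) (`image_digitPrefix_eq_piFinset`).

Finite expansions suffice: the box is then a union of elementary boxes, so the truncated indicator
has discrepancy zero over full blocks of indices. Truncation can err only where a coordinate's
digits end in an infinite run of b-1, and for each coordinate this happens for at most one index.

Conversely, let the expansion of one γ_i be infinite and the discrepancy be bounded by K. There are
positions j_t, as many and as far apart as desired, where the fractional part of γ_i b^(j_t) stays
away from 0 and 1. Up to a function of the earlier digits, digit j_t is the pairing with a series
w_t whose leading exponent d_t is near j_t (`exists_residuePairing_of_digitFunctional`). Take the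
window length L = Σ b^(d_t) and let S(a) be the discrepancy over the indices from a b^L to a b^L + L
- 1, so that |S| ≤ 2K. For each t a mean-zero function ρ_t of the pairing of w_t with X^L f_a, where
f_a is the polynomial of a, correlates with S by at least a fixed c > 0
(`exists_correlating_function`): complete blocks cancel in the index and in the coordinate, and the
incomplete ones are controlled by the form of L and by the fractional part. These test functions are
orthogonal because they involve different digits. With T² of them the total correlation is at least
cT², while the sum of the test functions has L² norm at most T; hence cT² ≤ 2KT + 1, which fails for
large T (`le_of_orthogonal_correlations`). -/

/-! ### Polynomials as Laurent series in 1/x -/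

open Polynomial in
theorem toLaurentAtInfinity_C_mul_X_pow {F : Type*} [Field F] (a : F) (n : ℕ) :
    toLaurentAtInfinity F (C a * X ^ n) = HahnSeries.single (-(n : ℤ)) a := by
  simp only [toLaurentAtInfinity, coe_eval₂RingHom, eval₂_mul, eval₂_C, eval₂_X_pow,
    HahnSeries.single_pow, HahnSeries.C_apply, HahnSeries.single_mul_single]
  simp

open Polynomial in
theorem toLaurentAtInfinity_coeff_neg {F : Type*} [Field F] (f : F[X]) (n : ℕ) :
    (toLaurentAtInfinity F f).coeff (-(n : ℤ)) = f.coeff n := by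
  induction f using Polynomial.induction_on' with
  | add p q hp hq => rw [map_add, HahnSeries.coeff_add, hp, hq, coeff_add]
  | monomial m a =>
    rw [← C_mul_X_pow_eq_monomial, toLaurentAtInfinity_C_mul_X_pow, coeff_C_mul_X_pow,
      HahnSeries.coeff_single]
    simp

open Polynomial in
theorem toLaurentAtInfinity_coeff_pos {F : Type*} [Field F] (f : F[X]) {z : ℤ} (hz : 0 < z) :
    (toLaurentAtInfinity F f).coeff z = 0 := by
  induction f using Polynomial.induction_on' with
  | add p q hp hq => rw [map_add, HahnSeries.coeff_add, hp, hq, add_zero]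
  | monomial m a =>
    rw [← C_mul_X_pow_eq_monomial, toLaurentAtInfinity_C_mul_X_pow,
      HahnSeries.coeff_single_of_ne (by omega)]

open Polynomial in
theorem toLaurentAtInfinity_injective (F : Type*) [Field F] :
    Function.Injective (toLaurentAtInfinity F) := by
  intro f g h
  ext n
  rw [← toLaurentAtInfinity_coeff_neg, h, toLaurentAtInfinity_coeff_neg]

open Polynomial in
theorem toLaurentAtInfinity_ne_zero {F : Type*} [Field F] {f : F[X]} (hf : f ≠ 0) :
    toLaurentAtInfinity F f ≠ 0 := fun h =>
  hf (toLaurentAtInfinity_injective F (h.trans (map_zero _).symm))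

open Polynomial in
theorem toLaurentAtInfinity_order {F : Type*} [Field F] {f : F[X]} (hf : f ≠ 0) :
    (toLaurentAtInfinity F f).order = -(f.natDegree : ℤ) := by
  apply le_antisymm
  · apply HahnSeries.order_le_of_coeff_ne_zero
    rw [toLaurentAtInfinity_coeff_neg]
    simpa using hf
  · by_contra! h
    have h1 := HahnSeries.coeff_order_eq_zero.not.2 (toLaurentAtInfinity_ne_zero hf)
    obtain ⟨n, hn⟩ : ∃ n : ℕ, (toLaurentAtInfinity F f).order = -(n : ℤ) :=
      ⟨(-(toLaurentAtInfinity F f).order).toNat, by omega⟩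
    rw [hn, toLaurentAtInfinity_coeff_neg] at h1
    have := le_natDegree_of_ne_zero h1
    omega

open Polynomial in
theorem order_toLaurentAtInfinity_div {F : Type*} [Field F] {f g : F[X]} (hf : f ≠ 0)
    (hg : g ≠ 0) :
    (toLaurentAtInfinity F f / toLaurentAtInfinity F g).order =
      (g.natDegree : ℤ) - f.natDegree := by
  have hf' := toLaurentAtInfinity_ne_zero hf
  have hg' := toLaurentAtInfinity_ne_zero hg
  have h := HahnSeries.order_mul (div_ne_zero hf' hg') hg'
  rw [div_mul_cancel₀ _ hg', toLaurentAtInfinity_order hf, toLaurentAtInfinity_order hg] at h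
  omega

/-! ### The residue pairing and the digit functionals -/

open Polynomial in
/-- The pairing of a polynomial `f` with a Laurent series `w` in `x⁻¹`: the coefficient of `x⁻¹`
in `f w`. -/
noncomputable def residuePairing {F : Type*} [Field F] (w : LaurentSeries F) : F[X] →ₗ[F] F where
  toFun f := (toLaurentAtInfinity F f * w).coeff 1
  map_add' f g := by simp [add_mul]
  map_smul' c f := by
    have : toLaurentAtInfinity F (c • f) = HahnSeries.C c * toLaurentAtInfinity F f := by
      rw [smul_eq_C_mul, map_mul]
      simp [toLaurentAtInfinity]
    rw [this, mul_assoc, HahnSeries.C_apply, HahnSeries.coeff_single_zero_mul]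
    simp

open Polynomial in
theorem residuePairing_apply {F : Type*} [Field F] (w : LaurentSeries F) (f : F[X]) :
    residuePairing w f = (toLaurentAtInfinity F f * w).coeff 1 := rfl

open Polynomial in
theorem residuePairing_C_mul_X_pow {F : Type*} [Field F] (w : LaurentSeries F) (a : F) (n : ℕ) :
    residuePairing w (C a * X ^ n) = a * w.coeff ((n : ℤ) + 1) := by
  rw [residuePairing_apply, toLaurentAtInfinity_C_mul_X_pow]
  have := HahnSeries.coeff_single_mul_add (r := a) (x := w) (a := (n : ℤ) + 1) (b := -(n : ℤ))
  rw [← this]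
  congr 1
  ring

open Polynomial in
theorem residuePairing_eq_sum {F : Type*} [Field F] (w : LaurentSeries F) (f : F[X]) {n : ℕ}
    (hn : f.natDegree < n) :
    residuePairing w f = ∑ r ∈ Finset.range n, f.coeff r * w.coeff ((r : ℤ) + 1) := by
  conv_lhs => rw [f.as_sum_range_C_mul_X_pow' hn]
  rw [map_sum]
  exact Finset.sum_congr rfl fun r _ => residuePairing_C_mul_X_pow w _ r

open Polynomial in
theorem residuePairing_mul {F : Type*} [Field F] (w : LaurentSeries F) (f g : F[X]) :
    residuePairing w (f * g) = residuePairing (toLaurentAtInfinity F g * w) f := by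
  rw [residuePairing_apply, residuePairing_apply, map_mul, mul_assoc]

open Polynomial in
theorem residuePairing_toLaurentAtInfinity {F : Type*} [Field F] (f g : F[X]) :
    residuePairing (toLaurentAtInfinity F g) f = 0 := by
  rw [residuePairing_apply, ← map_mul]
  exact toLaurentAtInfinity_coeff_pos _ one_pos

open Polynomial in
theorem residuePairing_add_left {F : Type*} [Field F] (v w : LaurentSeries F) (f : F[X]) :
    residuePairing (v + w) f = residuePairing v f + residuePairing w f := by
  simp [residuePairing_apply, mul_add]

open Polynomial in
theorem residuePairing_div_eq_zero_of_dvd {F : Type*} [Field F] (y : F[X]) {q f : F[X]}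
    (hq : q ≠ 0) (h : q ∣ f) :
    residuePairing (toLaurentAtInfinity F y / toLaurentAtInfinity F q) f = 0 := by
  obtain ⟨g, rfl⟩ := h
  have hq' := toLaurentAtInfinity_ne_zero hq
  rw [mul_comm, residuePairing_mul, mul_div_cancel₀ _ hq', residuePairing_toLaurentAtInfinity]

-- Nondegeneracy of the pairing modulo p: a nonzero remainder of f, multiplied by a suitable power
-- of X and divided by p, has leading term of exponent exactly -1.
open Polynomial in
theorem dvd_of_residuePairing_eq_zero {F : Type*} [Field F] {p f : F[X]} (hp : p ≠ 0)
    (h : ∀ z, residuePairing (toLaurentAtInfinity F z / toLaurentAtInfinity F p) f = 0) :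
    p ∣ f := by
  by_contra hd
  have hr : f % p ≠ 0 := fun h0 => hd ((EuclideanDomain.mod_eq_zero).1 h0)
  have hdeg : (f % p).natDegree < p.natDegree := by
    refine natDegree_lt_natDegree hr (EuclideanDomain.mod_lt f hp)
  have hres : ∀ z, residuePairing (toLaurentAtInfinity F z / toLaurentAtInfinity F p) (f % p)
      = 0 := by
    intro z
    have h1 := h z
    rw [← EuclideanDomain.mod_add_div f p, map_add,
      residuePairing_div_eq_zero_of_dvd z hp (dvd_mul_right _ _), add_zero] at h1
    exact h1
  have h2 := hres (X ^ (p.natDegree - 1 - (f % p).natDegree))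
  rw [residuePairing_apply, ← mul_div_assoc, ← map_mul] at h2
  have hne : f % p * X ^ (p.natDegree - 1 - (f % p).natDegree) ≠ 0 :=
    mul_ne_zero hr (pow_ne_zero _ X_ne_zero)
  have h3 := HahnSeries.coeff_order_eq_zero.not.2
    (div_ne_zero (toLaurentAtInfinity_ne_zero hne) (toLaurentAtInfinity_ne_zero hp))
  rw [order_toLaurentAtInfinity_div hne hp, natDegree_mul_X_pow _ hr] at h3
  apply h3
  rw [← h2]
  congr 1
  omega

open Polynomial in
/-- The functional that computes the `j`-th digit of the generalized Niederreiter sequence. -/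
noncomputable def digitFunctional {F : Type*} [Field F] (p : F[X]) (y : ℕ → ℕ → F[X]) (j : ℕ) :
    F[X] →ₗ[F] F :=
  residuePairing (toLaurentAtInfinity F (y (j / p.natDegree + 1) (j % p.natDegree)) /
    toLaurentAtInfinity F (p ^ (j / p.natDegree + 1)))

open Polynomial in
theorem span_mk_eq_top {F : Type*} [Field F] {p : F[X]} (hp : p ≠ 0) {y : ℕ → F[X]}
    (hy : LinearIndependent F (fun k : Fin p.natDegree => AdjoinRoot.mk p (y k))) :
    Submodule.span F (Set.range fun k : Fin p.natDegree => AdjoinRoot.mk p (y k)) = ⊤ := by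
  have := (AdjoinRoot.powerBasis hp).finite
  apply hy.span_eq_top_of_card_eq_finrank'
  rw [(AdjoinRoot.powerBasis hp).finrank, AdjoinRoot.powerBasis_dim hp, Fintype.card_fin]

-- The pairing with z/p at f is symmetric in z and f and depends only on z modulo p, so testing on a
-- basis of F[X]/(p) is enough.
open Polynomial in
theorem dvd_of_residuePairing_basis_eq_zero {F : Type*} [Field F] {p : F[X]} (hp : p ≠ 0)
    {y : ℕ → F[X]}
    (hy : LinearIndependent F (fun k : Fin p.natDegree => AdjoinRoot.mk p (y k))) {f : F[X]}
    (h : ∀ k < p.natDegree,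
      residuePairing (toLaurentAtInfinity F (y k) / toLaurentAtInfinity F p) f = 0) : p ∣ f := by
  apply dvd_of_residuePairing_eq_zero hp
  have hL : ∀ z : F[X], residuePairing (toLaurentAtInfinity F z / toLaurentAtInfinity F p) f =
      residuePairing (toLaurentAtInfinity F f / toLaurentAtInfinity F p) z := by
    intro z
    rw [residuePairing_apply, residuePairing_apply]
    congr 1
    ring
  have hp' := toLaurentAtInfinity_ne_zero hp
  intro z
  have hz : AdjoinRoot.mk p z ∈ Submodule.span F
      (Set.range fun k : Fin p.natDegree => AdjoinRoot.mk p (y k)) := by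
    rw [span_mk_eq_top hp hy]; trivial
  obtain ⟨c, hc⟩ := (Submodule.mem_span_range_iff_exists_fun F).1 hz
  have hd : p ∣ z - ∑ k, c k • y k := by
    rw [← AdjoinRoot.mk_eq_zero, map_sub, sub_eq_zero, ← hc, map_sum]
    exact Finset.sum_congr rfl fun k _ => (AdjoinRoot.smul_mk _ _ _)
  have h1 := residuePairing_div_eq_zero_of_dvd f hp hd
  rw [map_sub, map_sum, ← hL, sub_eq_zero] at h1
  rw [h1]
  refine Finset.sum_eq_zero fun k _ => ?_
  rw [map_smul, ← hL, h k k.2, smul_zero]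

open Polynomial in
theorem digitFunctional_eq_zero_of_dvd {F : Type*} [Field F] {p : F[X]} (hp : 1 ≤ p.natDegree)
    (y : ℕ → ℕ → F[X]) {m j : ℕ} (hj : j < p.natDegree * m) {f : F[X]} (h : p ^ m ∣ f) :
    digitFunctional p y j f = 0 := by
  have hp0 : p ≠ 0 := ne_zero_of_natDegree_gt hp
  apply residuePairing_div_eq_zero_of_dvd _ (pow_ne_zero _ hp0)
  exact (pow_dvd_pow p (Nat.div_lt_of_lt_mul hj)).trans h

-- Digits come in groups of deg p. Once f = p^m g, group m pairs f with y/p^(m+1), which is the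
-- pairing of g with y/p; its vanishing yields one more factor p.
open Polynomial in
theorem pow_dvd_iff_digitFunctional_eq_zero {F : Type*} [Field F] {p : F[X]}
    (hp : 1 ≤ p.natDegree) {y : ℕ → ℕ → F[X]}
    (hy : ∀ j, 1 ≤ j → LinearIndependent F
      (fun k : Fin p.natDegree => AdjoinRoot.mk p (y j k))) (m : ℕ) (f : F[X]) :
    p ^ m ∣ f ↔ ∀ j < p.natDegree * m, digitFunctional p y j f = 0 := by
  have hp0 : p ≠ 0 := ne_zero_of_natDegree_gt hp
  refine ⟨fun h j hj => digitFunctional_eq_zero_of_dvd hp y hj h, ?_⟩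
  induction m with
  | zero => simp
  | succ m ih =>
    intro h
    obtain ⟨g, rfl⟩ := ih fun j hj => h j (hj.trans_le (by gcongr; omega))
    rw [pow_succ]
    refine mul_dvd_mul_left _ (dvd_of_residuePairing_basis_eq_zero hp0 (hy (m + 1) (by omega)) ?_)
    intro k hk
    have h1 := h (p.natDegree * m + k) (by rw [mul_add]; omega)
    rw [digitFunctional, Nat.mul_add_div (by omega), Nat.div_eq_of_lt hk, Nat.mul_add_mod,
      Nat.mod_eq_of_lt hk, add_zero, mul_comm, residuePairing_mul] at h1
    rw [← h1]
    congr 2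
    have hp' := toLaurentAtInfinity_ne_zero hp0
    rw [map_pow, map_pow]
    field_simp
    ring

open Polynomial in
/-- Modulo a functional that is determined by the residue class modulo `p ^ Q`, the digit functional
`j = Q deg p + k` is the pairing with a series whose order lies between `Q deg p + 1` and
`(Q + 1) deg p`. -/
theorem exists_residuePairing_of_digitFunctional {F : Type*} [Field F] {p : F[X]}
    (hp : 1 ≤ p.natDegree) {y : ℕ → ℕ → F[X]}
    (hy : ∀ j, 1 ≤ j → LinearIndependent F
      (fun k : Fin p.natDegree => AdjoinRoot.mk p (y j k))) (j : ℕ) :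
    ∃ (w : LaurentSeries F) (d : ℕ), j < d + p.natDegree ∧ d < j + p.natDegree ∧
      w.coeff ((d : ℤ) + 1) ≠ 0 ∧ (∀ r < d, w.coeff ((r : ℤ) + 1) = 0) ∧
      ∀ f, (∀ i < j, digitFunctional p y i f = 0) → residuePairing w f = digitFunctional p y j f := by
  have hp0 : p ≠ 0 := ne_zero_of_natDegree_gt hp
  set Q := j / p.natDegree with hQ
  set k := j % p.natDegree with hk
  have hkl : k < p.natDegree := Nat.mod_lt _ hp
  have hj : p.natDegree * Q + k = j := Nat.div_add_mod _ _
  have hp' := toLaurentAtInfinity_ne_zero hp0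
  set z := y (Q + 1) k with hz
  have hz0 : z % p ≠ 0 := by
    intro h0
    have := (hy (Q + 1) (Nat.le_add_left 1 Q)).ne_zero ⟨k, hkl⟩
    exact this (AdjoinRoot.mk_eq_zero.2 ((EuclideanDomain.mod_eq_zero).1 h0))
  have hdeg : (z % p).natDegree < p.natDegree :=
    natDegree_lt_natDegree hz0 (EuclideanDomain.mod_lt z hp0)
  have hord := order_toLaurentAtInfinity_div hz0 (pow_ne_zero (Q + 1) hp0)
  have hne := div_ne_zero (toLaurentAtInfinity_ne_zero hz0)
    (toLaurentAtInfinity_ne_zero (pow_ne_zero (Q + 1) hp0))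
  rw [natDegree_pow] at hord
  have hexp : (Q + 1) * p.natDegree = p.natDegree * Q + p.natDegree := by ring
  rw [hexp] at hord
  -- Replacing the numerator z by z % p changes the series by (z / p)/p^Q, which pairs to zero with
  -- multiples of p^Q. The order of the new series is (Q + 1) deg p - deg (z % p), and this is d +
  -- 1.
  refine ⟨toLaurentAtInfinity F (z % p) / toLaurentAtInfinity F (p ^ (Q + 1)),
    p.natDegree * Q + p.natDegree - (z % p).natDegree - 1, by omega, by omega, ?_, ?_, ?_⟩
  · have := HahnSeries.coeff_order_eq_zero.not.2 hne
    rw [hord] at this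
    convert! this using 2
    omega
  · intro r hr
    apply HahnSeries.coeff_eq_zero_of_lt_order
    rw [hord]
    omega
  · intro f hf
    have hd : p ^ Q ∣ f := (pow_dvd_iff_digitFunctional_eq_zero hp hy Q f).2
      fun i hi => hf i (by omega)
    have : digitFunctional p y j f = residuePairing
        (toLaurentAtInfinity F (z % p) / toLaurentAtInfinity F (p ^ (Q + 1)) +
          toLaurentAtInfinity F (z / p) / toLaurentAtInfinity F (p ^ Q)) f := by
      unfold digitFunctional
      congr 2
      rw [← hQ, ← hk, ← hz]
      conv_lhs => rw [← EuclideanDomain.mod_add_div z p]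
      rw [map_add, map_mul, map_pow, map_pow]
      field_simp
      ring
    rw [this, residuePairing_add_left,
      residuePairing_div_eq_zero_of_dvd _ (pow_ne_zero Q hp0) hd, add_zero]

/-! ### Base-b digits of the index and the associated polynomial -/

theorem one_lt_of_equiv_field {F : Type*} [Field F] {b : ℕ} (φ : Fin b ≃ F) : 1 < b := by
  have : Nontrivial (Fin b) := φ.nontrivial
  exact Fin.nontrivial_iff_two_le.1 this

open Polynomial in
/-- The polynomial whose coefficients correspond under `φ` to the `b`-adic digits of `n`. -/
noncomputable def digitPoly {F : Type*} [Field F] (b : ℕ) [NeZero b] (φ : Fin b ≃ F) (n : ℕ) :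
    F[X] :=
  ∑ r ∈ Finset.range (Nat.digits b n).length, C (φ (natDigit b n r)) * X ^ r

theorem natDigit_eq_zero_of_lt {b : ℕ} [NeZero b] {n r : ℕ} (h : n < b ^ r) :
    natDigit b n r = 0 := by
  rw [natDigit, Nat.div_eq_of_lt h]
  rfl

theorem natDigit_val {b : ℕ} [NeZero b] (n r : ℕ) : (natDigit b n r : ℕ) = n / b ^ r % b := rfl

theorem natDigit_mul_pow_add {b : ℕ} [NeZero b] (a k : ℕ) {l : ℕ} (hl : l < b ^ k) (r : ℕ) :
    natDigit b (a * b ^ k + l) r = if r < k then natDigit b l r else natDigit b a (r - k) := by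
  have hb := NeZero.pos b
  split_ifs with h
  · ext
    obtain ⟨t, rfl⟩ := Nat.exists_eq_add_of_lt h
    rw [natDigit_val, natDigit_val,
      show a * b ^ (r + t + 1) + l = (a * b ^ t * b) * b ^ r + l by ring, add_comm,
      Nat.add_mul_div_right _ _ (by positivity), Nat.add_mul_mod_self_right]
  · ext
    obtain ⟨t, rfl⟩ := Nat.exists_eq_add_of_le (not_lt.1 h)
    rw [natDigit_val, natDigit_val, pow_add, ← Nat.div_div_eq_div_mul, add_comm,
      Nat.add_mul_div_right _ _ (by positivity), Nat.div_eq_of_lt hl, zero_add,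
      Nat.add_sub_cancel_left]

theorem eq_of_natDigit_eq {b : ℕ} [NeZero b] (hb : 1 < b) {m n : ℕ}
    (h : ∀ r, natDigit b m r = natDigit b n r) : m = n := by
  obtain ⟨k, hm, hn⟩ : ∃ k, m < b ^ k ∧ n < b ^ k :=
    ⟨m + n, (Nat.lt_pow_self hb).trans_le (Nat.pow_le_pow_right hb.le (by omega)),
      (Nat.lt_pow_self hb).trans_le (Nat.pow_le_pow_right hb.le (by omega))⟩
  have key : ∀ k, m % b ^ k = n % b ^ k := by
    intro k
    induction k with
    | zero => simp [Nat.mod_one]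
    | succ k ih =>
      rw [Nat.mod_pow_succ, Nat.mod_pow_succ, ih, ← natDigit_val, ← natDigit_val, h]
  have := key k
  rwa [Nat.mod_eq_of_lt hm, Nat.mod_eq_of_lt hn] at this

section DigitPoly
open Polynomial
variable {F : Type*} [Field F] {b : ℕ} [NeZero b] {φ : Fin b ≃ F}

theorem digitPoly_coeff (hφ : φ 0 = 0) (n r : ℕ) :
    (digitPoly b φ n).coeff r = φ (natDigit b n r) := by
  have hb := one_lt_of_equiv_field φ
  simp only [digitPoly, finsetSum_coeff, coeff_C_mul_X_pow, Finset.sum_ite_eq, Finset.mem_range]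
  split_ifs with h
  · rfl
  · rw [natDigit_eq_zero_of_lt, hφ]
    exact (Nat.lt_base_pow_length_digits hb).trans_le (Nat.pow_le_pow_right hb.le (not_lt.1 h))

theorem digitPoly_degree_lt (hφ : φ 0 = 0) {n k : ℕ} (h : n < b ^ k) :
    (digitPoly b φ n).degree < k := by
  rw [degree_lt_iff_coeff_zero]
  intro r hr
  rw [digitPoly_coeff hφ, natDigit_eq_zero_of_lt, hφ]
  exact h.trans_le (Nat.pow_le_pow_right (NeZero.pos b) hr)

theorem digitPoly_injective (hφ : φ 0 = 0) : Function.Injective (digitPoly b φ) := by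
  intro m n h
  apply eq_of_natDigit_eq (one_lt_of_equiv_field φ)
  intro r
  apply φ.injective
  rw [← digitPoly_coeff hφ, h, digitPoly_coeff hφ]

theorem digitPoly_mul_pow_add (hφ : φ 0 = 0) (a k : ℕ) {l : ℕ} (hl : l < b ^ k) :
    digitPoly b φ (a * b ^ k + l) = X ^ k * digitPoly b φ a + digitPoly b φ l := by
  ext r
  rw [coeff_add, coeff_X_pow_mul', digitPoly_coeff hφ, digitPoly_coeff hφ, digitPoly_coeff hφ,
    natDigit_mul_pow_add a k hl]
  split_ifs with h1 h2 h2
  · omega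
  · rw [zero_add]
  · rw [natDigit_eq_zero_of_lt (hl.trans_le (Nat.pow_le_pow_right (NeZero.pos b) h2)), hφ, add_zero]
  · omega

theorem residuePairing_digitPoly (w : LaurentSeries F) (n : ℕ) :
    residuePairing w (digitPoly b φ n) =
      ∑ r ∈ Finset.range (Nat.digits b n).length, φ (natDigit b n r) * w.coeff ((r : ℤ) + 1) := by
  rw [digitPoly, map_sum]
  exact Finset.sum_congr rfl fun r _ => residuePairing_C_mul_X_pow w _ r

theorem generalizedNiederreiterSequence_apply {s : ℕ} (p : Fin s → F[X])
    (y : Fin s → ℕ → ℕ → F[X]) (n : ℕ) (i : Fin s) :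
    generalizedNiederreiterSequence b φ p y n i =
      Real.ofDigits fun j => φ.symm (digitFunctional (p i) (y i) j (digitPoly b φ n)) := by
  simp only [generalizedNiederreiterSequence, digitalSequence, niederreiterMatrix, expansionCoeff,
    digitFunctional, residuePairing_digitPoly]

end DigitPoly

/-! ### Integers formed by leading digits -/

section PrefixNat
variable {b : ℕ}

/-- The number whose `b`-adic digits, from the most significant one on, are
`δ 0, …, δ (J - 1)`. -/
def prefixNat (δ : ℕ → Fin b) : ℕ → ℕ
  | 0 => 0
  | J + 1 => b * prefixNat δ J + δ J

theorem prefixNat_lt (δ : ℕ → Fin b) (J : ℕ) : prefixNat δ J < b ^ J := by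
  induction J with
  | zero => simp [prefixNat]
  | succ J ih =>
    have h : b * (prefixNat δ J + 1) ≤ b * b ^ J := Nat.mul_le_mul_left b ih
    have := (δ J).2
    rw [prefixNat, pow_succ']
    rw [mul_add] at h
    omega

theorem prefixNat_add_div (δ : ℕ → Fin b) (J u : ℕ) :
    prefixNat δ (J + u) / b ^ u = prefixNat δ J := by
  induction u with
  | zero => simp
  | succ u ih =>
    have := (δ (J + u)).2
    rw [← add_assoc, prefixNat, pow_succ', ← Nat.div_div_eq_div_mul, Nat.mul_add_div (by omega),
      Nat.div_eq_of_lt this, add_zero, ih]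

theorem prefixNat_succ_mod (δ : ℕ → Fin b) (J : ℕ) : prefixNat δ (J + 1) % b = δ J := by
  rw [prefixNat, Nat.mul_add_mod, Nat.mod_eq_of_lt (δ J).2]

theorem prefixNat_eq_iff (δ δ' : ℕ → Fin b) (J : ℕ) :
    prefixNat δ J = prefixNat δ' J ↔ ∀ j < J, δ j = δ' j := by
  induction J with
  | zero => simp [prefixNat]
  | succ J ih =>
    constructor
    · intro h j hj
      rcases Nat.lt_succ_iff_lt_or_eq.1 hj with hj | rfl
      · refine ih.1 ?_ j hj
        rw [← prefixNat_add_div δ J 1, h, prefixNat_add_div]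
      · ext
        rw [← prefixNat_succ_mod, h, prefixNat_succ_mod]
    · intro h
      rw [prefixNat, prefixNat, ih.2 fun j hj => h j (by omega), h J (by omega)]

theorem sum_ofDigitsTerm_eq_prefixNat (δ : ℕ → Fin b) (J : ℕ) :
    ∑ j ∈ Finset.range J, Real.ofDigitsTerm δ j = prefixNat δ J / (b : ℝ) ^ J := by
  have hb : (b : ℝ) ≠ 0 := by exact_mod_cast (Fin.pos (δ 0)).ne'
  induction J with
  | zero => simp [prefixNat]
  | succ J ih =>
    rw [Finset.sum_range_succ, ih, Real.ofDigitsTerm, prefixNat]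
    push_cast
    field_simp
    ring

theorem ofDigits_eq_prefixNat_add (δ : ℕ → Fin b) (J : ℕ) :
    Real.ofDigits δ =
      (prefixNat δ J + Real.ofDigits fun j => δ (j + J)) / (b : ℝ) ^ J := by
  rw [Real.ofDigits_eq_sum_add_ofDigits δ J, sum_ofDigitsTerm_eq_prefixNat]
  ring

theorem prefixNat_div_le_ofDigits (δ : ℕ → Fin b) (J : ℕ) :
    prefixNat δ J / (b : ℝ) ^ J ≤ Real.ofDigits δ := by
  rw [ofDigits_eq_prefixNat_add δ J]
  have := Real.ofDigits_nonneg fun j => δ (j + J)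
  gcongr
  linarith

theorem ofDigits_le_prefixNat_div (δ : ℕ → Fin b) (J : ℕ) :
    Real.ofDigits δ ≤ (prefixNat δ J + 1) / (b : ℝ) ^ J := by
  rw [ofDigits_eq_prefixNat_add δ J]
  have := Real.ofDigits_le_one fun j => δ (j + J)
  gcongr

/-- The value sits at the right end of its b-adic interval only if all later digits are b - 1;
stated on integers, this determines every longer prefix. -/
theorem prefixNat_add_of_ofDigits_eq (δ : ℕ → Fin b) {J : ℕ}
    (h : Real.ofDigits δ = (prefixNat δ J + 1) / (b : ℝ) ^ J) (u : ℕ) :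
    prefixNat δ (J + u) + 1 = (prefixNat δ J + 1) * b ^ u := by
  have hb0 : 0 < b := Fin.pos (δ 0)
  have hb : (0 : ℝ) < b := by exact_mod_cast hb0
  apply le_antisymm
  · rw [Nat.succ_le_iff, ← Nat.div_lt_iff_lt_mul (by positivity), prefixNat_add_div]
    exact Nat.lt_succ_self _
  · have h1 := ofDigits_le_prefixNat_div δ (J + u)
    rw [h, div_le_div_iff₀ (by positivity) (by positivity), pow_add] at h1
    have h2 : ((prefixNat δ J + 1) * (b : ℝ) ^ u) * b ^ J ≤
        (prefixNat δ (J + u) + 1) * b ^ J := by linarith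
    have h3 := le_of_mul_le_mul_right h2 (by positivity)
    exact_mod_cast h3

end PrefixNat

section DigitPrefix
open Polynomial
variable {F : Type*} [Field F] {b : ℕ} (φ : Fin b ≃ F) (p : F[X]) (y : ℕ → ℕ → F[X])

/-- The number with the digits `0, …, J - 1` that the polynomial `f` has in the coordinate
belonging to `p`. -/
noncomputable def digitPrefix (J : ℕ) (f : F[X]) : ℕ :=
  prefixNat (fun j => φ.symm (digitFunctional p y j f)) J

theorem digitPrefix_eq_iff (J : ℕ) (f g : F[X]) :
    digitPrefix φ p y J f = digitPrefix φ p y J g ↔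
      ∀ j < J, digitFunctional p y j (f - g) = 0 := by
  rw [digitPrefix, digitPrefix, prefixNat_eq_iff]
  simp only [EmbeddingLike.apply_eq_iff_eq, map_sub, sub_eq_zero]

variable {p y} in
theorem digitPrefix_eq_iff_dvd (hp : 1 ≤ p.natDegree)
    (hy : ∀ j, 1 ≤ j → LinearIndependent F
      (fun k : Fin p.natDegree => AdjoinRoot.mk p (y j k))) (m : ℕ) (f g : F[X]) :
    digitPrefix φ p y (p.natDegree * m) f = digitPrefix φ p y (p.natDegree * m) g ↔
      p ^ m ∣ f - g := by
  rw [digitPrefix_eq_iff, pow_dvd_iff_digitFunctional_eq_zero hp hy]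

end DigitPrefix

/-! ### Equidistribution of leading digits by the Chinese remainder theorem -/

section Bijection
open Polynomial
variable {F : Type*} [Field F] {b : ℕ} [NeZero b] {φ : Fin b ≃ F} {s : ℕ} {p : Fin s → F[X]}
  {y : Fin s → ℕ → ℕ → F[X]}

/-- Equal prefixes make the product of the p_i^m divide a difference of degree smaller than its own,
which gives injectivity; surjectivity follows by counting. The unit u and the shift c allow indices
a b^k + l with l fixed, where u = X^k. -/
theorem image_digitPrefix_eq_piFinset (hφ : φ 0 = 0) (hdeg : ∀ i, 1 ≤ (p i).natDegree)
    (hcop : ∀ i i', i ≠ i' → IsCoprime (p i) (p i'))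
    (hy : ∀ i j, 1 ≤ j → LinearIndependent F
      (fun k : Fin (p i).natDegree => AdjoinRoot.mk (p i) (y i j k)))
    {u : F[X]} (hu : ∀ i, IsCoprime u (p i)) (c : F[X]) (m : ℕ) :
    Set.InjOn (fun (a : ℕ) (i : Fin s) =>
        digitPrefix φ (p i) (y i) ((p i).natDegree * m) (u * digitPoly b φ a + c))
      (Finset.range (b ^ ∑ i, (p i).natDegree * m)) ∧
    (Finset.range (b ^ ∑ i, (p i).natDegree * m)).image (fun (a : ℕ) (i : Fin s) =>
        digitPrefix φ (p i) (y i) ((p i).natDegree * m) (u * digitPoly b φ a + c)) =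
      Fintype.piFinset fun i => Finset.range (b ^ ((p i).natDegree * m)) := by
  have hp0 : ∀ i, p i ≠ 0 := fun i => ne_zero_of_natDegree_gt (hdeg i)
  have hinj : Set.InjOn (fun (a : ℕ) (i : Fin s) =>
        digitPrefix φ (p i) (y i) ((p i).natDegree * m) (u * digitPoly b φ a + c))
      (Finset.range (b ^ ∑ i, (p i).natDegree * m)) := by
    intro a ha a' ha' h
    simp only [Finset.coe_range, Set.mem_Iio] at ha ha'
    have hd : ∀ i, p i ^ m ∣ digitPoly b φ a - digitPoly b φ a' := by
      intro i
      have h1 := (digitPrefix_eq_iff_dvd φ (hdeg i) (hy i) m _ _).1 (congrFun h i)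
      rw [add_sub_add_right_eq_sub, ← mul_sub] at h1
      exact ((hu i).pow_right (n := m)).symm.dvd_of_dvd_mul_left h1
    have hprod : ∏ i, p i ^ m ∣ digitPoly b φ a - digitPoly b φ a' :=
      Finset.prod_dvd_of_coprime (fun i _ i' _ hii => (hcop i i' hii).pow) fun i _ => hd i
    apply digitPoly_injective hφ
    rw [← sub_eq_zero]
    refine eq_zero_of_dvd_of_degree_lt hprod ?_
    rw [degree_prod, Finset.sum_congr rfl fun i _ => by
      rw [degree_pow, degree_eq_natDegree (hp0 i)]]
    refine ((degree_sub_le _ _).trans_lt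
      (max_lt (digitPoly_degree_lt hφ ha) (digitPoly_degree_lt hφ ha'))).trans_le (le_of_eq ?_)
    push_cast
    simp [mul_comm]
  refine ⟨hinj, Finset.eq_of_subset_of_card_le ?_ ?_⟩
  · intro x hx
    obtain ⟨a, -, rfl⟩ := Finset.mem_image.1 hx
    simp only [Fintype.mem_piFinset, Finset.mem_range]
    exact fun i => prefixNat_lt _ _
  · rw [Finset.card_image_of_injOn hinj, Fintype.card_piFinset]
    simp [Finset.prod_pow_eq_pow_sum]

theorem sum_digitPrefix_eq_sum_piFinset (hφ : φ 0 = 0) (hdeg : ∀ i, 1 ≤ (p i).natDegree)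
    (hcop : ∀ i i', i ≠ i' → IsCoprime (p i) (p i'))
    (hy : ∀ i j, 1 ≤ j → LinearIndependent F
      (fun k : Fin (p i).natDegree => AdjoinRoot.mk (p i) (y i j k)))
    {u : F[X]} (hu : ∀ i, IsCoprime u (p i)) (c : F[X]) (m : ℕ) (G : (Fin s → ℕ) → ℝ) :
    ∑ a ∈ Finset.range (b ^ ∑ i, (p i).natDegree * m), G (fun i : Fin s =>
        digitPrefix φ (p i) (y i) ((p i).natDegree * m) (u * digitPoly b φ a + c)) =
      ∑ x ∈ Fintype.piFinset fun i => Finset.range (b ^ ((p i).natDegree * m)), G x := by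
  obtain ⟨h1, h2⟩ := image_digitPrefix_eq_piFinset hφ hdeg hcop hy hu c m
  rw [← h2, Finset.sum_image h1]

end Bijection

/-! ### Truncating points and box sides -/

/-- The b-adic interval of the prefix is closed on the right, since a tail of digits b - 1 attains
its right end. Hence the interval just below the one containing γ must be excluded too. -/
theorem ofDigits_lt_iff_of_ne {b : ℕ} (δ : ℕ → Fin b) (W : ℕ) {γ : ℝ} (hγ : 0 ≤ γ)
    (h1 : prefixNat δ W + 1 ≠ ⌊γ * (b : ℝ) ^ W⌋₊) (h2 : prefixNat δ W ≠ ⌊γ * (b : ℝ) ^ W⌋₊) :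
    Real.ofDigits δ < γ ↔ prefixNat δ W < ⌊γ * (b : ℝ) ^ W⌋₊ := by
  have hb : (0 : ℝ) < (b : ℝ) ^ W := by
    have : (0 : ℝ) < b := by exact_mod_cast Fin.pos (δ 0)
    positivity
  constructor
  · intro h
    by_contra! hc
    have hc' : ⌊γ * (b : ℝ) ^ W⌋₊ + 1 ≤ prefixNat δ W := by omega
    have h3 := prefixNat_div_le_ofDigits δ W
    rw [div_le_iff₀ hb] at h3
    have h4 := Nat.lt_floor_add_one (γ * (b : ℝ) ^ W)
    have h5 : (⌊γ * (b : ℝ) ^ W⌋₊ : ℝ) + 1 ≤ prefixNat δ W := by exact_mod_cast hc'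
    nlinarith
  · intro h
    have hc' : prefixNat δ W + 1 + 1 ≤ ⌊γ * (b : ℝ) ^ W⌋₊ := by omega
    have h3 := ofDigits_le_prefixNat_div δ W
    rw [le_div_iff₀ hb] at h3
    have h4 := Nat.floor_le (mul_nonneg hγ hb.le)
    have h5 : (prefixNat δ W : ℝ) + 1 + 1 ≤ ⌊γ * (b : ℝ) ^ W⌋₊ := by exact_mod_cast hc'
    by_contra! hcon
    nlinarith

/-- When γ is itself an endpoint, the comparison can fail only for a point equal to γ that is
written with a tail of digits b - 1. -/
theorem ofDigits_lt_iff_of_eq_div {b : ℕ} (δ : ℕ → Fin b) {W g : ℕ} {γ : ℝ}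
    (hγ : γ = g / (b : ℝ) ^ W)
    (h : ¬ (prefixNat δ W + 1 = g ∧ Real.ofDigits δ = (prefixNat δ W + 1) / (b : ℝ) ^ W)) :
    Real.ofDigits δ < γ ↔ prefixNat δ W < g := by
  have hb : (0 : ℝ) < (b : ℝ) ^ W := by
    have : (0 : ℝ) < b := by exact_mod_cast Fin.pos (δ 0)
    positivity
  subst hγ
  constructor
  · intro h1
    have h3 := (prefixNat_div_le_ofDigits δ W).trans_lt h1
    rw [div_lt_div_iff_of_pos_right hb] at h3
    exact_mod_cast h3
  · intro h1
    have h3 := ofDigits_le_prefixNat_div δ W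
    rcases Nat.lt_or_eq_of_le (Nat.succ_le_of_lt h1) with h4 | h4
    · refine h3.trans_lt ?_
      rw [div_lt_div_iff_of_pos_right hb]
      exact_mod_cast h4
    · have h5 : (g : ℝ) = prefixNat δ W + 1 := by exact_mod_cast h4.symm
      rw [h5]
      exact lt_of_le_of_ne h3 fun h6 => h ⟨h4, h6⟩

theorem exists_eq_floor_div_of_hasFiniteExpansions {b : ℕ} [NeZero b] (hb : 1 < b) {s : ℕ}
    {γ : Fin s → ℝ} (hγ : ∀ i, γ i ∈ Set.Ioo (0 : ℝ) 1) (h : HasFiniteExpansions b γ) :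
    ∃ J, ∀ W, J ≤ W → ∀ i, γ i = ⌊γ i * (b : ℝ) ^ W⌋₊ / (b : ℝ) ^ W := by
  obtain ⟨J, hJ⟩ := h
  refine ⟨J + 1, fun W hW i => ?_⟩
  have hmem : γ i ∈ Set.Ico (0 : ℝ) 1 := ⟨(hγ i).1.le, (hγ i).2⟩
  have hb0 : (0 : ℝ) < (b : ℝ) ^ W := by
    have : (0 : ℝ) < b := by exact_mod_cast NeZero.pos b
    positivity
  have htail : (fun j => Real.digits (γ i) b (j + W)) = fun _ => 0 := by
    funext j
    by_contra hne
    have : j + W ≤ J := hJ ⟨i, hne⟩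
    omega
  have h1 := Real.ofDigits_digits_sum_eq hmem (b := b) W
  have h2 := Real.ofDigits_eq_sum_add_ofDigits (Real.digits (γ i) b) W
  rw [Real.ofDigits_digits hb hmem, htail] at h2
  have h3 : Real.ofDigits (fun _ : ℕ => (0 : Fin b)) = 0 := by
    simp [Real.ofDigits, Real.ofDigitsTerm]
  rw [h3, mul_zero, add_zero] at h2
  rw [← h2, mul_comm] at h1
  rw [← h1]
  field_simp

theorem hasFiniteExpansions_of_mul_pow_eq_natCast {b : ℕ} [NeZero b] {s : ℕ} {γ : Fin s → ℝ}
    (h : ∀ i, ∃ J g : ℕ, γ i * (b : ℝ) ^ J = g) : HasFiniteExpansions b γ := by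
  choose J g hJ using h
  refine ⟨∑ i, J i, ?_⟩
  rintro j ⟨i, hi⟩
  by_contra! hlt
  apply hi
  have hJi : J i ≤ ∑ i, J i := Finset.single_le_sum (fun _ _ => Nat.zero_le _) (Finset.mem_univ i)
  obtain ⟨t, ht⟩ := Nat.exists_eq_add_of_lt (hJi.trans_lt hlt)
  have h1 : γ i * (b : ℝ) ^ (j + 1) = ((g i * b ^ (t + 1) * b : ℕ) : ℝ) := by
    push_cast
    rw [← hJ i, ht]
    ring
  rw [Real.digits, h1, Nat.floor_natCast]
  ext
  simp

theorem anchoredBox_volume_real {s : ℕ} {γ : Fin s → ℝ} (hγ : ∀ i, 0 ≤ γ i) :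
    (MeasureTheory.volume : MeasureTheory.Measure _).real (anchoredBox γ) = ∏ i, γ i := by
  rw [MeasureTheory.measureReal_def, anchoredBox, MeasureTheory.volume_pi_pi, ENNReal.toReal_prod]
  simp [hγ]

open Classical in
theorem anchoredBox_indicator {s : ℕ} (γ : Fin s → ℝ) {x : Fin s → ℝ} (hx : ∀ i, 0 ≤ x i) :
    (anchoredBox γ).indicator (fun _ => (1 : ℝ)) x = ∏ i, if x i < γ i then 1 else 0 := by
  rw [Finset.prod_ite_zero, Set.indicator_apply]
  simp [anchoredBox, hx]

theorem prod_ite_mem_Icc {s : ℕ} (P : Fin s → Prop) [∀ i, Decidable (P i)] :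
    (∏ i, if P i then (1 : ℝ) else 0) ∈ Set.Icc (0 : ℝ) 1 := by
  rw [Finset.prod_ite_zero]
  split_ifs <;> simp

theorem abs_prod_ite_sub_prod_ite_le {s : ℕ} (P Q E : Fin s → Prop) [∀ i, Decidable (P i)]
    [∀ i, Decidable (Q i)] [∀ i, Decidable (E i)] (h : ∀ i, ¬ E i → (P i ↔ Q i)) :
    |(∏ i, if P i then (1 : ℝ) else 0) - ∏ i, if Q i then (1 : ℝ) else 0| ≤
      ∑ i, if E i then (1 : ℝ) else 0 := by
  have h0 : ∀ i ∈ Finset.univ, (0 : ℝ) ≤ if E i then (1 : ℝ) else 0 := fun i _ => by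
    split_ifs <;> simp
  by_cases hE : ∃ i, E i
  · obtain ⟨i, hi⟩ := hE
    have h1 := Finset.single_le_sum h0 (Finset.mem_univ i)
    rw [if_pos hi] at h1
    refine le_trans ?_ h1
    have hP := prod_ite_mem_Icc P
    have hQ := prod_ite_mem_Icc Q
    rw [abs_le]
    constructor <;> linarith [hP.1, hP.2, hQ.1, hQ.2]
  · push Not at hE
    have : ∀ i, (if P i then (1 : ℝ) else 0) = if Q i then 1 else 0 := fun i => by
      simp [h i (hE i)]
    simp only [this, sub_self, abs_zero]
    exact Finset.sum_nonneg h0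

theorem abs_sum_range_le_of_block_sum_eq_zero {h : ℕ → ℝ} {B : ℕ} (hB : 0 < B)
    (h1 : ∀ n, |h n| ≤ 1) (h0 : ∀ t, ∑ a ∈ Finset.range B, h (t * B + a) = 0) (N : ℕ) :
    |∑ n ∈ Finset.range N, h n| ≤ B := by
  have hblock : ∀ t, ∑ n ∈ Finset.range (t * B), h n = 0 := by
    intro t
    induction t with
    | zero => simp
    | succ t ih => rw [Nat.succ_mul, Finset.sum_range_add, ih, h0, add_zero]
  rw [← Nat.div_add_mod' N B, Finset.sum_range_add, hblock, zero_add]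
  calc |∑ x ∈ Finset.range (N % B), h (N / B * B + x)|
      ≤ ∑ x ∈ Finset.range (N % B), |h (N / B * B + x)| := Finset.abs_sum_le_sum_abs _ _
    _ ≤ ∑ x ∈ Finset.range (N % B), 1 := Finset.sum_le_sum fun x _ => h1 _
    _ ≤ B := by
      simp only [Finset.sum_const, Finset.card_range, nsmul_eq_mul, mul_one]
      exact_mod_cast (Nat.mod_lt N hB).le

theorem sum_range_ite_lt {B g : ℕ} (h : g ≤ B) (f : ℕ → ℝ) :
    ∑ x ∈ Finset.range B, (if x < g then f x else 0) = ∑ x ∈ Finset.range g, f x := by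
  rw [← Finset.sum_filter]
  congr 1
  ext x
  simp only [Finset.mem_filter, Finset.mem_range]
  omega

/-! ### Finite expansions give bounded remainder -/

section Approximation
open Polynomial
variable {F : Type*} [Field F] {b : ℕ} [NeZero b] {φ : Fin b ≃ F} {s : ℕ} {p : Fin s → F[X]}
  {y : Fin s → ℕ → ℕ → F[X]}

theorem isBoundedRemainderSet_of_hasFiniteExpansions (hφ : φ 0 = 0)
    (hdeg : ∀ i, 1 ≤ (p i).natDegree) (hcop : ∀ i i', i ≠ i' → IsCoprime (p i) (p i'))
    (hy : ∀ i j, 1 ≤ j → LinearIndependent F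
      (fun k : Fin (p i).natDegree => AdjoinRoot.mk (p i) (y i j k)))
    {γ : Fin s → ℝ} (hγ : ∀ i, γ i ∈ Set.Ioo (0 : ℝ) 1) (hfin : HasFiniteExpansions b γ) :
    IsBoundedRemainderSet (anchoredBox γ) (generalizedNiederreiterSequence b φ p y) := by
  classical
  have hb := one_lt_of_equiv_field φ
  have hb0 : (0 : ℝ) < b := by exact_mod_cast NeZero.pos b
  obtain ⟨m, hm⟩ := exists_eq_floor_div_of_hasFiniteExpansions hb hγ hfin
  set W : Fin s → ℕ := fun i => (p i).natDegree * m with hW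
  have hmW : ∀ i, m ≤ W i := fun i => Nat.le_mul_of_pos_left m (hdeg i)
  set g : Fin s → ℕ := fun i => ⌊γ i * (b : ℝ) ^ W i⌋₊ with hg
  have hγg : ∀ i, γ i = g i / (b : ℝ) ^ W i := fun i => hm _ (hmW i) i
  have hgle : ∀ i, g i ≤ b ^ W i := by
    intro i
    have h1 : (g i : ℝ) ≤ (b : ℝ) ^ W i := by
      have := (hγ i).2.le
      rwa [hγg i, div_le_one (by positivity)] at this
    exact_mod_cast h1
  set δ : ℕ → Fin s → ℕ → Fin b :=
    fun n i j => φ.symm (digitFunctional (p i) (y i) j (digitPoly b φ n)) with hδ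
  set E : Fin s → ℕ → Prop := fun i n => prefixNat (δ n i) (W i) + 1 = g i ∧
    Real.ofDigits (δ n i) = (prefixNat (δ n i) (W i) + 1) / (b : ℝ) ^ W i with hE
  -- Two exceptional indices share all digits in coordinate i, since both have the prefix g i - 1
  -- followed by digits b - 1. So the difference f of their polynomials is divisible by a power of
  -- p_i of degree above deg f, and f = 0.
  have hEsub : ∀ i n n', E i n → E i n' → n = n' := by
    intro i n n' hn hn'
    apply digitPoly_injective hφ
    rw [← sub_eq_zero]
    by_contra hne
    set f := digitPoly b φ n - digitPoly b φ n' with hf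
    have hp0 : p i ≠ 0 := ne_zero_of_natDegree_gt (hdeg i)
    have hd : p i ^ (m + (f.natDegree + 1)) ∣ f := by
      rw [← digitPrefix_eq_iff_dvd φ (hdeg i) (hy i), digitPrefix, digitPrefix, mul_add]
      have h1 := prefixNat_add_of_ofDigits_eq _ hn.2 ((p i).natDegree * (f.natDegree + 1))
      have h2 := prefixNat_add_of_ofDigits_eq _ hn'.2 ((p i).natDegree * (f.natDegree + 1))
      rw [hn.1] at h1
      rw [hn'.1, ← h1] at h2
      exact (Nat.succ_injective h2).symm
    have h3 := natDegree_le_of_dvd hd hne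
    rw [natDegree_pow] at h3
    have h4 : m + (f.natDegree + 1) ≤ (m + (f.natDegree + 1)) * (p i).natDegree :=
      Nat.le_mul_of_pos_right _ (hdeg i)
    omega
  set a : ℕ → ℝ := fun n => ∏ i, if prefixNat (δ n i) (W i) < g i then (1 : ℝ) else 0 with ha
  have hvol := anchoredBox_volume_real fun i => (hγ i).1.le
  have hind : ∀ n, |(anchoredBox γ).indicator (fun _ => (1 : ℝ))
      (generalizedNiederreiterSequence b φ p y n) - a n| ≤ ∑ i, if E i n then (1 : ℝ) else 0 := by
    intro n
    rw [anchoredBox_indicator γ fun i => by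
      rw [generalizedNiederreiterSequence_apply]; exact Real.ofDigits_nonneg _]
    apply abs_prod_ite_sub_prod_ite_le
    intro i hi
    rw [generalizedNiederreiterSequence_apply]
    exact ofDigits_lt_iff_of_eq_div _ (hγg i) hi
  have hblock : ∀ t, ∑ x ∈ Finset.range (b ^ ∑ i, W i), (a (t * b ^ (∑ i, W i) + x) - ∏ i, γ i)
      = 0 := by
    intro t
    have h1 := sum_digitPrefix_eq_sum_piFinset (φ := φ) hφ hdeg hcop hy (u := 1)
      (fun i => isCoprime_one_left) (X ^ (∑ i, W i) * digitPoly b φ t) m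
      (fun x => ∏ i, if x i < g i then (1 : ℝ) else 0)
    rw [← Finset.prod_univ_sum (fun i => Finset.range (b ^ ((p i).natDegree * m)))
      (fun i x => if x < g i then (1 : ℝ) else 0)] at h1
    rw [Finset.sum_sub_distrib, sub_eq_zero]
    refine Eq.trans (Finset.sum_congr rfl fun x hx => ?_) (h1.trans ?_)
    · simp only [ha, hδ, hW, digitPrefix]
      rw [digitPoly_mul_pow_add hφ _ _ (Finset.mem_range.1 hx), one_mul, add_comm]
    · simp only [Finset.sum_const, Finset.card_range, nsmul_eq_mul]
      push_cast
      rw [← Finset.prod_pow_eq_pow_sum, ← Finset.prod_mul_distrib]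
      refine Finset.prod_congr rfl fun i _ => ?_
      rw [sum_range_ite_lt (hgle i) fun _ => 1]
      conv_rhs => rw [hγg i]
      simp only [Finset.sum_const, Finset.card_range, nsmul_eq_mul, mul_one]
      field_simp
  have hγ01 : (∏ i, γ i) ∈ Set.Icc (0 : ℝ) 1 :=
    ⟨Finset.prod_nonneg fun i _ => (hγ i).1.le,
      Finset.prod_le_one (fun i _ => (hγ i).1.le) fun i _ => (hγ i).2.le⟩
  -- One exceptional index per coordinate gives s; the last incomplete block gives the block length.
  refine ⟨s + (b ^ ∑ i, W i : ℕ), fun N => ?_⟩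
  have hsplit : discrepancyFunction (anchoredBox γ) (generalizedNiederreiterSequence b φ p y) N =
      ∑ n ∈ Finset.range N, ((anchoredBox γ).indicator (fun _ => (1 : ℝ))
        (generalizedNiederreiterSequence b φ p y n) - a n) +
      ∑ n ∈ Finset.range N, (a n - ∏ i, γ i) := by
    rw [discrepancyFunction, hvol, ← Finset.sum_add_distrib]
    exact Finset.sum_congr rfl fun n _ => by ring
  rw [hsplit]
  refine (abs_add_le _ _).trans (add_le_add ?_ ?_)
  · calc _ ≤ ∑ n ∈ Finset.range N, |(anchoredBox γ).indicator (fun _ => (1 : ℝ))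
          (generalizedNiederreiterSequence b φ p y n) - a n| := Finset.abs_sum_le_sum_abs _ _
      _ ≤ ∑ n ∈ Finset.range N, ∑ i, if E i n then (1 : ℝ) else 0 :=
        Finset.sum_le_sum fun n _ => hind n
      _ = ∑ i, ∑ n ∈ Finset.range N, if E i n then (1 : ℝ) else 0 := Finset.sum_comm
      _ ≤ ∑ i : Fin s, 1 := by
        refine Finset.sum_le_sum fun i _ => ?_
        rw [Finset.sum_boole]
        have : (Finset.filter (fun n => E i n) (Finset.range N)).card ≤ 1 := by
          rw [Finset.card_le_one]
          intro n hn n' hn'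
          exact hEsub i n n' (Finset.mem_filter.1 hn).2 (Finset.mem_filter.1 hn').2
        exact_mod_cast this
      _ = s := by simp
  · refine abs_sum_range_le_of_block_sum_eq_zero (Nat.pow_pos (NeZero.pos b)) ?_ hblock N
    intro n
    have h1 := prod_ite_mem_Icc fun i => prefixNat (δ n i) (W i) < g i
    rw [abs_le]
    constructor <;> linarith [h1.1, h1.2, hγ01.1, hγ01.2]

end Approximation

/-! ### Cancellation over digit blocks and the correlating function -/

theorem sum_range_mul_eq_sum_sum (f : ℕ → ℝ) (t B : ℕ) :
    ∑ n ∈ Finset.range (t * B), f n =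
      ∑ a ∈ Finset.range t, ∑ r ∈ Finset.range B, f (a * B + r) := by
  induction t with
  | zero => simp
  | succ t ih => rw [Nat.succ_mul, Finset.sum_range_add, ih, Finset.sum_range_succ]

theorem natDigit_div_pow {b : ℕ} [NeZero b] (n k r : ℕ) :
    natDigit b (n / b ^ k) r = natDigit b n (k + r) := by
  ext
  rw [natDigit_val, natDigit_val, Nat.div_div_eq_div_mul, pow_add]

theorem sum_natDigit {b : ℕ} [NeZero b] (u : ℕ) (f : Fin b → ℝ) :
    ∑ x ∈ Finset.range (b ^ (u + 1)), f (natDigit b x u) = (b : ℝ) ^ u * ∑ c, f c := by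
  rw [pow_succ', sum_range_mul_eq_sum_sum, Finset.mul_sum, Finset.sum_range]
  refine Finset.sum_congr rfl fun c _ => ?_
  have : ∀ r ∈ Finset.range (b ^ u), f (natDigit b (c * b ^ u + r) u) = f c := by
    intro r hr
    rw [natDigit_mul_pow_add _ _ (Finset.mem_range.1 hr), if_neg (lt_irrefl u), Nat.sub_self]
    congr 1
    ext
    rw [natDigit_val, pow_zero, Nat.div_one, Nat.mod_eq_of_lt c.2]
  rw [Finset.sum_congr rfl this]
  simp

theorem sum_comp_add_equiv {F : Type*} [Field F] [Fintype F] {b : ℕ} {ρ : F → ℝ} (hρ : ∑ z, ρ z = 0) (σ : Fin b ≃ F) (z : F) :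
    ∑ c, ρ (z + σ c) = 0 := by
  rw [← hρ]
  exact (σ.trans (Equiv.addLeft z)).sum_comp ρ

section BlockSum
variable {F : Type*} [Field F] [Fintype F] {b : ℕ} [NeZero b]

/-- In a sum over `x < g`, all the full blocks of length `b ^ (u + 1)` cancel. -/
theorem sum_range_block {ρ : F → ℝ} (hρ : ∑ z, ρ z = 0) (σ : Fin b ≃ F) (h : ℕ → ℝ) (Λ : ℕ → F)
    (u g : ℕ) :
    ∑ x ∈ Finset.range g, h (x / b ^ (u + 1)) * ρ (Λ (x / b ^ (u + 1)) + σ (natDigit b x u)) =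
      h (g / b ^ (u + 1)) * ∑ x ∈ Finset.range (g % b ^ (u + 1)),
        ρ (Λ (g / b ^ (u + 1)) + σ (natDigit b x u)) := by
  have hB : 0 < b ^ (u + 1) := Nat.pow_pos (NeZero.pos b)
  have key : ∀ a, ∀ r < b ^ (u + 1),
      h ((a * b ^ (u + 1) + r) / b ^ (u + 1)) * ρ (Λ ((a * b ^ (u + 1) + r) / b ^ (u + 1)) +
        σ (natDigit b (a * b ^ (u + 1) + r) u)) = h a * ρ (Λ a + σ (natDigit b r u)) := by
    intro a r hr
    rw [natDigit_mul_pow_add _ _ hr, if_pos (Nat.lt_succ_self u), mul_comm a,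
      Nat.mul_add_div hB, Nat.div_eq_of_lt hr, add_zero]
  conv_lhs => rw [← Nat.div_add_mod' g (b ^ (u + 1)), Finset.sum_range_add,
    sum_range_mul_eq_sum_sum]
  rw [Finset.sum_eq_zero, zero_add, Finset.mul_sum]
  · exact Finset.sum_congr rfl fun r hr => key _ r
      ((Finset.mem_range.1 hr).trans (Nat.mod_lt _ hB))
  · intro a _
    rw [Finset.sum_congr rfl fun r hr => key a r (Finset.mem_range.1 hr), ← Finset.mul_sum,
      sum_natDigit u fun c => ρ (Λ a + σ c), sum_comp_add_equiv hρ, mul_zero, mul_zero]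

end BlockSum

section DigitFrequency
variable {b : ℕ} [NeZero b]

/-- The proportion of the block `{x | natDigit b x u = c}` in `[0, b ^ (u + 1))` that lies
below `g`. -/
noncomputable def digitFrequency (b : ℕ) [NeZero b] (u g : ℕ) (c : Fin b) : ℝ :=
  (((Finset.range g).filter fun x => natDigit b x u = c).card : ℝ) / (b : ℝ) ^ u

theorem digitFrequency_nonneg (u g : ℕ) (c : Fin b) : 0 ≤ digitFrequency b u g c := by
  unfold digitFrequency
  positivity

theorem card_filter_natDigit_eq (u : ℕ) (c : Fin b) :
    (((Finset.range (b ^ (u + 1))).filter fun x => natDigit b x u = c).card : ℝ) =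
      (b : ℝ) ^ u := by
  have := sum_natDigit u fun c' => if c' = c then (1 : ℝ) else 0
  rw [Finset.sum_boole] at this
  rw [this]
  simp

theorem digitFrequency_le_one {u g : ℕ} (hg : g ≤ b ^ (u + 1)) (c : Fin b) :
    digitFrequency b u g c ≤ 1 := by
  have hb : (0 : ℝ) < b := by exact_mod_cast NeZero.pos b
  rw [digitFrequency, div_le_one (by positivity), ← card_filter_natDigit_eq u c]
  exact_mod_cast Finset.card_le_card (Finset.filter_subset_filter _ (Finset.range_mono hg))

theorem sum_range_natDigit_eq (u g : ℕ) (f : Fin b → ℝ) :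
    ∑ x ∈ Finset.range g, f (natDigit b x u) =
      (b : ℝ) ^ u * ∑ c, digitFrequency b u g c * f c := by
  have hb : (0 : ℝ) < b := by exact_mod_cast NeZero.pos b
  rw [← Finset.sum_fiberwise_of_maps_to (t := Finset.univ) (g := fun x => natDigit b x u)
    (fun _ _ => Finset.mem_univ _), Finset.mul_sum]
  refine Finset.sum_congr rfl fun c _ => ?_
  rw [Finset.sum_congr rfl fun x hx => by rw [(Finset.mem_filter.1 hx).2], digitFrequency]
  simp only [Finset.sum_const, nsmul_eq_mul]
  field_simp

theorem sum_digitFrequency (u g : ℕ) :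
    ∑ c, digitFrequency b u g c = g / (b : ℝ) ^ u := by
  have hb : (0 : ℝ) < b := by exact_mod_cast NeZero.pos b
  have := sum_range_natDigit_eq (b := b) u g fun _ => 1
  simp only [Finset.sum_const, Finset.card_range, nsmul_eq_mul, mul_one] at this
  rw [this]
  field_simp

/-- Below b^u the digit at place u is 0. Either g < b^u and the digit 1 does not occur, or all b^u
numbers with digit 0 lie below g. An extreme frequency of this kind forces variance around any mean
away from 0 and 1. -/
theorem exists_digitFrequency_eq (hb : 1 < b) (u g : ℕ) :
    ∃ c, digitFrequency b u g c = 0 ∨ 1 ≤ digitFrequency b u g c := by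
  have hb0 : (0 : ℝ) < b := by exact_mod_cast NeZero.pos b
  rcases lt_or_ge g (b ^ u) with h | h
  · refine ⟨⟨1, hb⟩, Or.inl ?_⟩
    rw [digitFrequency, Finset.card_eq_zero.2, Nat.cast_zero, zero_div]
    refine Finset.filter_eq_empty_iff.2 fun x hx => ?_
    rw [natDigit_eq_zero_of_lt ((Finset.mem_range.1 hx).trans h)]
    simp [Fin.ext_iff]
  · refine ⟨0, Or.inr ?_⟩
    rw [digitFrequency, le_div_iff₀ (by positivity), one_mul]
    have : Finset.range (b ^ u) ⊆ (Finset.range g).filter fun x => natDigit b x u = 0 := by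
      intro x hx
      rw [Finset.mem_range] at hx
      simp [hx.trans_le h, natDigit_eq_zero_of_lt hx]
    have h2 := Finset.card_le_card this
    rw [Finset.card_range] at h2
    exact_mod_cast h2

theorem le_sum_sq_digitFrequency_sub (hb : 1 < b) (u g : ℕ) {μ μ₀ : ℝ} (h0 : 0 ≤ μ₀)
    (h1 : μ₀ ≤ μ) (h2 : μ ≤ 1 - μ₀) : μ₀ ^ 2 ≤ ∑ c, (digitFrequency b u g c - μ) ^ 2 := by
  obtain ⟨c, hc⟩ := exists_digitFrequency_eq hb u g
  refine le_trans ?_ (Finset.single_le_sum (f := fun c => (digitFrequency b u g c - μ) ^ 2)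
    (fun _ _ => sq_nonneg _) (Finset.mem_univ c))
  rw [sq_le_sq, abs_of_nonneg h0, le_abs]
  rcases hc with hc | hc
  · right; linarith
  · left; linarith

end DigitFrequency

theorem neg_sum_sq_le_sum_mul_comp {ι : Type*} [Fintype ι] (f : ι → ℝ) (τ : Equiv.Perm ι) :
    -∑ c, f c ^ 2 ≤ ∑ c, f c * f (τ c) := by
  have h1 : ∑ c, f (τ c) ^ 2 = ∑ c, f c ^ 2 := Equiv.sum_comp τ fun c => f c ^ 2
  have h2 : 0 ≤ ∑ c, (f c + f (τ c)) ^ 2 := Finset.sum_nonneg fun _ _ => sq_nonneg _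
  have h3 : ∑ c, (f c + f (τ c)) ^ 2 =
      ∑ c, f c ^ 2 + 2 * ∑ c, f c * f (τ c) + ∑ c, f (τ c) ^ 2 := by
    rw [Finset.mul_sum, ← Finset.sum_add_distrib, ← Finset.sum_add_distrib]
    exact Finset.sum_congr rfl fun _ _ => by ring
  linarith

/-- A function on `F` of mean zero that correlates with the sums over `[0, L)` of the shifts of the
indicator function of `[0, g)`. -/
theorem exists_correlating_function {F : Type*} [Field F] [Fintype F] {b : ℕ} [NeZero b]
    {φ : Fin b ≃ F} (hφ : φ 0 = 0) (Λ Λ' : ℕ → F) {κ : F} (hκ : κ ≠ 0) {u d g L rest : ℕ} {μ₀ : ℝ}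
    (h0 : 0 ≤ μ₀) (h1 : μ₀ ≤ (g % b ^ (u + 1) : ℕ) / (b : ℝ) ^ (u + 1))
    (h2 : (g % b ^ (u + 1) : ℕ) / (b : ℝ) ^ (u + 1) ≤ 1 - μ₀)
    (hL : L % b ^ (d + 1) = b ^ d + rest) (hrest : 2 * rest ≤ b ^ d) :
    ∃ ρ : F → ℝ, (∀ z, |ρ z| ≤ 1) ∧ ∑ z, ρ z = 0 ∧
      (b : ℝ) ^ u * ((b : ℝ) ^ d / 2) * μ₀ ^ 2 ≤
        ∑ l ∈ Finset.range L, ∑ x ∈ Finset.range g,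
          ρ (Λ (x / b ^ (u + 1)) + φ (natDigit b x u) -
            (Λ' (l / b ^ (d + 1)) + φ (natDigit b l d) * κ)) := by
  have hb := one_lt_of_equiv_field φ
  have hb0 : (0 : ℝ) < b := by exact_mod_cast NeZero.pos b
  set g₁ := g % b ^ (u + 1) with hg₁
  have hg₁le : g₁ ≤ b ^ (u + 1) := (Nat.mod_lt _ (Nat.pow_pos (NeZero.pos b))).le
  set μ : ℝ := g₁ / (b : ℝ) ^ (u + 1) with hμ
  set q : Fin b → ℝ := digitFrequency b u g₁ with hq
  set f : Fin b → ℝ := fun c => q c - μ with hf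
  have hfsum : ∑ c, f c = 0 := by
    simp only [hf, Finset.sum_sub_distrib, hq, sum_digitFrequency, Finset.sum_const,
      Finset.card_univ, Fintype.card_fin, nsmul_eq_mul, hμ]
    rw [pow_succ]
    field_simp
    ring
  -- The offset C collects what the incomplete last blocks in x and l contribute, so that on them ρ
  -- becomes the centred frequency f itself.
  set C : F := Λ (g / b ^ (u + 1)) - Λ' (L / b ^ (d + 1)) with hC
  set ρ : F → ℝ := fun z => f (φ.symm (z - C)) with hρ
  have hρsum : ∑ z, ρ z = 0 := by
    rw [← hfsum]
    exact ((Equiv.subRight C).trans φ.symm).sum_comp f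
  refine ⟨ρ, fun z => ?_, hρsum, ?_⟩
  · have h3 := digitFrequency_nonneg u g₁ (φ.symm (z - C))
    have h4 := digitFrequency_le_one hg₁le (φ.symm (z - C))
    simp only [hρ, hf, hq]
    rw [abs_le]
    constructor <;> linarith
  have hx : ∀ v : F, ∑ x ∈ Finset.range g,
      ρ (Λ (x / b ^ (u + 1)) + φ (natDigit b x u) - v) =
        (b : ℝ) ^ u * ∑ c, q c * ρ (Λ (g / b ^ (u + 1)) + φ c - v) := by
    intro v
    have h3 := sum_range_block hρsum φ (fun _ => 1) (fun n => Λ n - v) u g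
    simp only [one_mul] at h3
    simp only [add_sub_right_comm]
    rw [h3, ← hg₁, hq, ← sum_range_natDigit_eq]
  set σ : Fin b ≃ F := φ.trans (Equiv.mulRight₀ (-κ) (neg_ne_zero.2 hκ)) with hσ
  have hσap : ∀ c, σ c = -(φ c * κ) := fun c => by simp [hσ]
  -- After the full blocks cancel, b^d + rest values of l remain: the first b^d have digit 0 at
  -- place d, the others digit 1.
  have hl : ∀ v : F, ∑ l ∈ Finset.range L,
      ρ (v - (Λ' (l / b ^ (d + 1)) + φ (natDigit b l d) * κ)) =
        (b : ℝ) ^ d * ρ (v - Λ' (L / b ^ (d + 1))) +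
          rest * ρ (v - Λ' (L / b ^ (d + 1)) - φ ⟨1, hb⟩ * κ) := by
    intro v
    have h3 := sum_range_block hρsum σ (fun _ => 1) (fun n => v - Λ' n) d L
    simp only [one_mul, hσap, ← sub_eq_add_neg] at h3
    simp only [← sub_sub]
    rw [h3, hL, Finset.sum_range_add]
    congr 1
    · rw [Finset.sum_congr rfl fun x hx => by
        rw [natDigit_eq_zero_of_lt (Finset.mem_range.1 hx), hφ, zero_mul, sub_zero]]
      simp
    · have h5 : ∀ x ∈ Finset.range rest, natDigit b (b ^ d + x) d = ⟨1, hb⟩ := by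
        intro x hx
        have hxd : x < b ^ d := by
          have := Finset.mem_range.1 hx
          omega
        have := natDigit_mul_pow_add (b := b) 1 d hxd d
        rw [one_mul, if_neg (lt_irrefl d), Nat.sub_self] at this
        rw [this]
        ext
        rw [natDigit_val, pow_zero, Nat.div_one, Nat.mod_eq_of_lt hb]
      rw [Finset.sum_congr rfl fun x hx => by rw [h5 x hx]]
      simp
  set τ : Equiv.Perm (Fin b) :=
    φ.trans ((Equiv.subRight (φ ⟨1, hb⟩ * κ)).trans φ.symm) with hτ
  have hS := le_sum_sq_digitFrequency_sub hb u g₁ h0 h1 h2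
  -- The frequencies may be centred because f ∘ τ has sum zero.
  have hqf : ∀ τ : Equiv.Perm (Fin b), ∑ c, q c * f (τ c) = ∑ c, f c * f (τ c) := by
    intro τ
    have h3 : ∑ c, f (τ c) = 0 := (Equiv.sum_comp τ f).trans hfsum
    have h4 : ∑ c, f c * f (τ c) = ∑ c, q c * f (τ c) - μ * ∑ c, f (τ c) := by
      rw [Finset.mul_sum, ← Finset.sum_sub_distrib]
      exact Finset.sum_congr rfl fun _ _ => by simp only [hf]; ring
    rw [h4, h3]
    ring
  have htotal : ∑ l ∈ Finset.range L, ∑ x ∈ Finset.range g,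
      ρ (Λ (x / b ^ (u + 1)) + φ (natDigit b x u) -
        (Λ' (l / b ^ (d + 1)) + φ (natDigit b l d) * κ)) =
      (b : ℝ) ^ u * ((b : ℝ) ^ d * ∑ c, f c ^ 2 + rest * ∑ c, f c * f (τ c)) := by
    simp only [hx]
    rw [← Finset.mul_sum, Finset.sum_comm]
    simp only [← Finset.mul_sum, hl]
    congr 1
    rw [← hqf τ, Finset.sum_congr rfl fun c _ => sq (f c),
      show ∑ c, f c * f c = ∑ c, q c * f c from (hqf (Equiv.refl _)).symm, Finset.mul_sum,
      Finset.mul_sum, ← Finset.sum_add_distrib]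
    refine Finset.sum_congr rfl fun c _ => ?_
    have h3 : ρ (Λ (g / b ^ (u + 1)) + φ c - Λ' (L / b ^ (d + 1))) = f c := by
      simp only [hρ, hC]
      congr 1
      rw [Equiv.symm_apply_eq]
      ring
    have h4 : ρ (Λ (g / b ^ (u + 1)) + φ c - Λ' (L / b ^ (d + 1)) - φ ⟨1, hb⟩ * κ) = f (τ c) := by
      simp only [hρ, hC, hτ, Equiv.trans_apply, Equiv.subRight_apply]
      congr 2
      ring
    rw [h3, h4]
    ring
  rw [htotal, mul_assoc]
  refine mul_le_mul_of_nonneg_left ?_ (by positivity)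
  have h5 := neg_sum_sq_le_sum_mul_comp f τ
  have h6 : 2 * (rest : ℝ) ≤ (b : ℝ) ^ d := by exact_mod_cast hrest
  have h7 : (0 : ℝ) ≤ rest := Nat.cast_nonneg _
  have hS0 : 0 ≤ ∑ c, f c ^ 2 := Finset.sum_nonneg fun _ _ => sq_nonneg _
  have hS' : μ₀ ^ 2 ≤ ∑ c, f c ^ 2 := hS
  -- The shifted correlation is at worst minus the variance, and rest ≤ b^d / 2 keeps half of the
  -- main term.
  calc (b : ℝ) ^ d / 2 * μ₀ ^ 2 ≤ (b : ℝ) ^ d / 2 * ∑ c, f c ^ 2 := by gcongr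
    _ ≤ ((b : ℝ) ^ d - rest) * ∑ c, f c ^ 2 := by gcongr; linarith
    _ = (b : ℝ) ^ d * ∑ c, f c ^ 2 + rest * -∑ c, f c ^ 2 := by ring
    _ ≤ _ := by gcongr

/-! ### The pairing read from the index and from the coordinate -/

section Representation
open Polynomial
variable {F : Type*} [Field F] {b : ℕ} [NeZero b] {φ : Fin b ≃ F}

/-- The series starts no earlier than exponent d + 1, so the digits of n below place d do not
contribute; digit d enters linearly, and only n / b^(d+1) matters beyond it. -/
theorem residuePairing_digitPoly_eq (hφ : φ 0 = 0) {w : LaurentSeries F} {d : ℕ}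
    (hw : ∀ r < d, w.coeff ((r : ℤ) + 1) = 0) (n : ℕ) :
    residuePairing w (digitPoly b φ n) =
      residuePairing w (X ^ (d + 1) * digitPoly b φ (n / b ^ (d + 1))) +
        φ (natDigit b n d) * w.coeff ((d : ℤ) + 1) := by
  have hlt : n % b ^ (d + 1) < b ^ (d + 1) := Nat.mod_lt _ (Nat.pow_pos (NeZero.pos b))
  have hn : n = n / b ^ (d + 1) * b ^ (d + 1) + n % b ^ (d + 1) := (Nat.div_add_mod' _ _).symm
  have hdig : natDigit b n d = natDigit b (n % b ^ (d + 1)) d := by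
    conv_lhs => rw [hn, natDigit_mul_pow_add _ _ hlt, if_pos (Nat.lt_succ_self d)]
  conv_lhs => rw [hn, digitPoly_mul_pow_add hφ _ _ hlt, map_add]
  have hdeg : (digitPoly b φ (n % b ^ (d + 1))).natDegree < d + 1 := by
    have := digitPoly_degree_lt hφ hlt
    rcases eq_or_ne (digitPoly b φ (n % b ^ (d + 1))) 0 with h0 | h0
    · simp [h0]
    · exact (natDegree_lt_iff_degree_lt h0).2 this
  rw [residuePairing_eq_sum w _ hdeg, Finset.sum_range_succ, Finset.sum_eq_zero, zero_add,
    digitPoly_coeff hφ, hdig]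
  intro r hr
  rw [hw r (Finset.mem_range.1 hr), mul_zero]

/-- The difference between the pairing and digit j is linear and vanishes when the first j digits
do, so it factors through the prefix of length j. In a prefix of length j + u + 1 that shorter
prefix is the quotient by b^(u+1), and digit j stands at place u from the right. -/
theorem exists_residuePairing_eq_digitPrefix (φ : Fin b ≃ F) {p : F[X]} {y : ℕ → ℕ → F[X]}
    {j : ℕ} {w : LaurentSeries F}
    (hw : ∀ f, (∀ i < j, digitFunctional p y i f = 0) →
      residuePairing w f = digitFunctional p y j f) :
    ∃ Λ : ℕ → F, ∀ u f, residuePairing w f =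
      Λ (digitPrefix φ p y (j + u + 1) f / b ^ (u + 1)) +
        φ (natDigit b (digitPrefix φ p y (j + u + 1) f) u) := by
  obtain ⟨Λ, hΛ⟩ := (Function.factorsThrough_iff
    (f := digitPrefix φ p y j) fun f => residuePairing w f - digitFunctional p y j f).1 (by
      intro f g hfg
      have h1 := hw _ ((digitPrefix_eq_iff φ p y j f g).1 hfg)
      rw [map_sub, map_sub] at h1
      simp only
      linear_combination h1)
  refine ⟨Λ, fun u f => ?_⟩
  have h1 : digitPrefix φ p y (j + u + 1) f / b ^ (u + 1) = digitPrefix φ p y j f :=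
    prefixNat_add_div _ j (u + 1)
  have h2 : natDigit b (digitPrefix φ p y (j + u + 1) f) u =
      φ.symm (digitFunctional p y j f) := by
    ext
    rw [natDigit_val, show j + u + 1 = j + 1 + u by ring, digitPrefix, prefixNat_add_div,
      prefixNat_succ_mod]
  have h3 := congrFun hΛ f
  simp only [Function.comp] at h3
  rw [h1, h2, Equiv.apply_symm_apply, ← h3]
  ring

end Representation

/-! ### Choice of the window length and of the digit positions -/

/-- Exponents at least 2 apart make each power of b at least four times its predecessor, so the
lower powers add up to at most half of b^(d t); the higher ones vanish modulo b^(d t + 1). -/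
theorem sum_pow_mod {b : ℕ} (hb : 1 < b) {d : ℕ → ℕ} (hd : ∀ t, d t + 2 ≤ d (t + 1)) {t M : ℕ}
    (ht : t < M) :
    ∃ rest, (∑ i ∈ Finset.range M, b ^ d i) % b ^ (d t + 1) = b ^ d t + rest ∧
      2 * rest ≤ b ^ d t := by
  have hrest : ∀ t, 2 * ∑ i ∈ Finset.range t, b ^ d i ≤ b ^ d t := by
    intro t
    induction t with
    | zero => simp
    | succ t ih =>
      rw [Finset.sum_range_succ]
      calc 2 * (∑ i ∈ Finset.range t, b ^ d i + b ^ d t) ≤ b ^ d t * 2 ^ 2 := by omega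
        _ ≤ b ^ d t * b ^ 2 := by gcongr; omega
        _ = b ^ (d t + 2) := by rw [pow_add]
        _ ≤ b ^ d (t + 1) := Nat.pow_le_pow_right (by omega) (hd t)
  have hmono : StrictMono d := strictMono_nat_of_lt_succ fun t => by have := hd t; omega
  refine ⟨∑ i ∈ Finset.range t, b ^ d i, ?_, hrest t⟩
  have h1 : b ^ (d t + 1) ∣ ∑ i ∈ Finset.Ico (t + 1) M, b ^ d i := by
    refine Finset.dvd_sum fun i hi => pow_dvd_pow b ?_
    have := hmono (Nat.lt_of_succ_le (Finset.mem_Ico.1 hi).1)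
    omega
  have h2 : b ^ d t + ∑ i ∈ Finset.range t, b ^ d i < b ^ (d t + 1) := by
    have h3 := hrest t
    have h4 : 0 < b ^ d t := Nat.pow_pos (by omega)
    have h5 : b ^ d t * 2 ≤ b ^ (d t + 1) := by
      rw [pow_succ]
      exact Nat.mul_le_mul_left _ hb
    omega
  rw [← Finset.sum_range_add_sum_Ico _ (Nat.succ_le_of_lt ht), Finset.sum_range_succ,
    Nat.add_mod, Nat.mod_eq_zero_of_dvd h1, add_zero, Nat.mod_mod, add_comm, Nat.mod_eq_of_lt h2]

/-- The distance from γ b^j to the nearest integer is multiplied by b at each step while it is below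
1/(2b). Being nonzero, it cannot stay there. -/
theorem exists_fract_mul_pow_mem {b : ℕ} (hb : 1 < b) {γ : ℝ}
    (h : ∀ J : ℕ, Int.fract (γ * (b : ℝ) ^ J) ≠ 0) (J₀ : ℕ) :
    ∃ j, J₀ ≤ j ∧ 1 / (2 * b : ℝ) ≤ Int.fract (γ * (b : ℝ) ^ j) ∧
      Int.fract (γ * (b : ℝ) ^ j) ≤ 1 - 1 / (2 * b : ℝ) := by
  have hb1 : (1 : ℝ) < b := by exact_mod_cast hb
  have hb0 : (0 : ℝ) < b := by linarith
  by_contra! hcon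
  set ε : ℝ := 1 / (2 * b : ℝ) with hε
  have hεb : b * ε = 1 / 2 := by rw [hε]; field_simp
  set v : ℕ → ℝ := fun t =>
    min (Int.fract (γ * (b : ℝ) ^ (J₀ + t))) (1 - Int.fract (γ * (b : ℝ) ^ (J₀ + t))) with hv
  have hvlt : ∀ t, v t < ε := by
    intro t
    have h1 := hcon (J₀ + t) (Nat.le_add_right _ _)
    rw [hv]
    simp only [min_lt_iff]
    by_cases h2 : ε ≤ Int.fract (γ * (b : ℝ) ^ (J₀ + t))
    · right; linarith [h1 h2]
    · left; linarith
  have hstep : ∀ t, v (t + 1) = b * v t := by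
    intro t
    have h1 : γ * (b : ℝ) ^ (J₀ + (t + 1)) = b * (γ * (b : ℝ) ^ (J₀ + t)) := by ring
    set z := γ * (b : ℝ) ^ (J₀ + t) with hz
    have h3 := hvlt t
    have h4 := Int.fract_nonneg z
    have h5 := Int.fract_lt_one z
    have h6 := Int.floor_add_fract z
    have h7 : v t = min (Int.fract z) (1 - Int.fract z) := rfl
    have h8 : v (t + 1) = min (Int.fract (b * z)) (1 - Int.fract (b * z)) := by
      rw [← h1]
    have h3' := h3
    rw [h7, min_lt_iff] at h3'
    have h2ε : ε ≤ 1 / 2 := by nlinarith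
    rcases h3' with h9 | h9
    · have h10 : Int.fract (b * z) = b * Int.fract z := by
        rw [Int.fract_eq_iff]
        refine ⟨by positivity, by nlinarith, b * ⌊z⌋, ?_⟩
        push_cast
        linear_combination (-(b : ℝ)) * h6
      rw [h8, h7, h10, min_eq_left, min_eq_left]
      · linarith
      · nlinarith
    · have h10 : Int.fract (b * z) = 1 - b * (1 - Int.fract z) := by
        rw [Int.fract_eq_iff]
        refine ⟨by nlinarith, by nlinarith, b * ⌊z⌋ + b - 1, ?_⟩
        push_cast
        linear_combination (-(b : ℝ)) * h6
      rw [h8, h7, h10, min_eq_right, min_eq_right]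
      · ring
      · linarith
      · nlinarith
  have hpow : ∀ t, v t = (b : ℝ) ^ t * v 0 := by
    intro t
    induction t with
    | zero => simp
    | succ t ih => rw [hstep, ih]; ring
  have hv0 : 0 < v 0 := by
    have h1 := lt_of_le_of_ne (Int.fract_nonneg (γ * (b : ℝ) ^ (J₀ + 0))) (h _).symm
    have h2 := Int.fract_lt_one (γ * (b : ℝ) ^ (J₀ + 0))
    exact lt_min h1 (by linarith)
  obtain ⟨t, ht⟩ := pow_unbounded_of_one_lt (ε / v 0) hb1
  rw [div_lt_iff₀ hv0, ← hpow] at ht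
  exact lt_asymm ht (hvlt t)

theorem sum_piFinset_prod_erase_mul {s : ℕ} (t : Fin s → Finset ℕ) (f : Fin s → ℕ → ℝ)
    (i₀ : Fin s) (H : ℕ → ℝ) :
    ∑ x ∈ Fintype.piFinset t, (∏ i ∈ Finset.univ.erase i₀, f i (x i)) * H (x i₀) =
      (∏ i ∈ Finset.univ.erase i₀, ∑ j ∈ t i, f i j) * ∑ j ∈ t i₀, H j := by
  have h := Finset.prod_univ_sum t (Function.update f i₀ H)
  rw [← Finset.prod_erase_mul _ _ (Finset.mem_univ i₀), Function.update_self] at h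
  rw [Finset.prod_congr rfl fun i hi => by
    rw [Function.update_of_ne (Finset.ne_of_mem_erase hi)]] at h
  rw [h]
  refine Finset.sum_congr rfl fun x _ => ?_
  rw [← Finset.prod_erase_mul _ _ (Finset.mem_univ i₀), Function.update_self]
  congr 1
  refine Finset.prod_congr rfl fun i hi => ?_
  rw [Function.update_of_ne (Finset.ne_of_mem_erase hi)]

/-- This quotient is the fractional part of γ b^j truncated to u + 1 digits. For u ≥ 2 the
truncation error is at most b^(-3) ≤ 1/(4b), half of the margin. -/
theorem mod_div_pow_mem_Icc {b : ℕ} [NeZero b] (hb : 1 < b) {γ : ℝ} (hγ : 0 ≤ γ) {j u : ℕ}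
    (hu : 2 ≤ u) (h1 : 1 / (2 * b : ℝ) ≤ Int.fract (γ * (b : ℝ) ^ j))
    (h2 : Int.fract (γ * (b : ℝ) ^ j) ≤ 1 - 1 / (2 * b : ℝ)) :
    ((⌊γ * (b : ℝ) ^ (j + u + 1)⌋₊ % b ^ (u + 1) : ℕ) : ℝ) / (b : ℝ) ^ (u + 1) ∈
      Set.Icc (1 / (4 * b : ℝ)) (1 - 1 / (4 * b : ℝ)) := by
  have hb1 : (2 : ℝ) ≤ b := by exact_mod_cast hb
  have hb0 : (0 : ℝ) < b := by linarith
  set g := ⌊γ * (b : ℝ) ^ (j + u + 1)⌋₊ with hg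
  have hB : (0 : ℝ) < (b : ℝ) ^ (u + 1) := by positivity
  have hz : γ * (b : ℝ) ^ (j + u + 1) = γ * (b : ℝ) ^ j * (b : ℝ) ^ (u + 1) := by ring
  set z := γ * (b : ℝ) ^ j with hzdef
  have hz0 : 0 ≤ z := by positivity
  have hdiv : g / b ^ (u + 1) = ⌊z⌋₊ := by
    rw [hg, ← Nat.floor_div_natCast]
    congr 1
    push_cast
    rw [hz]
    field_simp
  have hmod : ((g % b ^ (u + 1) : ℕ) : ℝ) = g - (b : ℝ) ^ (u + 1) * ⌊z⌋₊ := by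
    have := Nat.div_add_mod g (b ^ (u + 1))
    rw [hdiv] at this
    have h3 : (b : ℝ) ^ (u + 1) * ⌊z⌋₊ + ((g % b ^ (u + 1) : ℕ) : ℝ) = g := by exact_mod_cast this
    linarith
  have hfr : Int.fract z = z - ⌊z⌋₊ := by
    rw [natCast_floor_eq_intCast_floor hz0]
    exact (Int.self_sub_floor z).symm
  have hg1 : (g : ℝ) ≤ z * (b : ℝ) ^ (u + 1) := by
    rw [← hz]; exact Nat.floor_le (by positivity)
  have hg2 : z * (b : ℝ) ^ (u + 1) < g + 1 := by
    rw [← hz]; exact Nat.lt_floor_add_one _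
  have hbu : (4 * b : ℝ) ≤ (b : ℝ) ^ (u + 1) := by
    calc (4 * b : ℝ) ≤ (b : ℝ) ^ 3 := by nlinarith [mul_nonneg hb0.le (sub_nonneg.2 hb1)]
      _ ≤ (b : ℝ) ^ (u + 1) := pow_le_pow_right₀ (by linarith) (by omega)
  have h4 : 1 / (2 * b : ℝ) = 2 * (1 / (4 * b : ℝ)) := by field_simp; norm_num
  have h5 : 1 ≤ 1 / (4 * b : ℝ) * (b : ℝ) ^ (u + 1) := by
    rw [div_mul_eq_mul_div, one_mul, le_div_iff₀ (by positivity), one_mul]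
    exact hbu
  have h6 : (0 : ℝ) < 1 / (4 * b : ℝ) := by positivity
  rw [h4, hfr] at h1 h2
  rw [Set.mem_Icc, le_div_iff₀ hB, div_le_iff₀ hB, hmod]
  constructor
  · nlinarith
  · nlinarith

/-! ### Sums over truncated boxes -/

section BoxSums
open Polynomial
variable {F : Type*} [Field F] {b : ℕ} [NeZero b] {φ : Fin b ≃ F} {s : ℕ} {p : Fin s → F[X]}
  {y : Fin s → ℕ → ℕ → F[X]}

/-- The bijection turns the sum over a into a sum over a product grid, which factors by coordinates.
-/
theorem sum_box_mul_digitPrefix (hφ : φ 0 = 0) (hdeg : ∀ i, 1 ≤ (p i).natDegree)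
    (hcop : ∀ i i', i ≠ i' → IsCoprime (p i) (p i'))
    (hy : ∀ i j, 1 ≤ j → LinearIndependent F
      (fun k : Fin (p i).natDegree => AdjoinRoot.mk (p i) (y i j k)))
    {u : F[X]} (hu : ∀ i, IsCoprime u (p i)) (c : F[X]) (m : ℕ) {g : Fin s → ℕ}
    (hg : ∀ i, g i ≤ b ^ ((p i).natDegree * m)) (i₀ : Fin s) (H : ℕ → ℝ) :
    ∑ a ∈ Finset.range (b ^ ∑ i, (p i).natDegree * m),
      (∏ i, if digitPrefix φ (p i) (y i) ((p i).natDegree * m) (u * digitPoly b φ a + c) < g i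
        then (1 : ℝ) else 0) *
      H (digitPrefix φ (p i₀) (y i₀) ((p i₀).natDegree * m) (u * digitPoly b φ a + c)) =
    (∏ i ∈ Finset.univ.erase i₀, (g i : ℝ)) * ∑ x ∈ Finset.range (g i₀), H x := by
  rw [sum_digitPrefix_eq_sum_piFinset hφ hdeg hcop hy hu c m
    (fun x => (∏ i, if x i < g i then (1 : ℝ) else 0) * H (x i₀))]
  have h1 : ∀ x : Fin s → ℕ, (∏ i, if x i < g i then (1 : ℝ) else 0) * H (x i₀) =
      (∏ i ∈ Finset.univ.erase i₀, if x i < g i then (1 : ℝ) else 0) *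
        (if x i₀ < g i₀ then H (x i₀) else 0) := by
    intro x
    rw [← Finset.prod_erase_mul _ _ (Finset.mem_univ i₀), mul_assoc, ite_mul, one_mul, zero_mul]
  simp only [h1]
  rw [sum_piFinset_prod_erase_mul _ (fun i x => if x < g i then (1 : ℝ) else 0) i₀
    (fun x => if x < g i₀ then H x else 0), sum_range_ite_lt (hg i₀)]
  congr 1
  refine Finset.prod_congr rfl fun i _ => ?_
  rw [sum_range_ite_lt (hg i) fun _ => 1]
  simp

theorem sum_comp_digitPrefix (hφ : φ 0 = 0) (hdeg : ∀ i, 1 ≤ (p i).natDegree)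
    (hcop : ∀ i i', i ≠ i' → IsCoprime (p i) (p i'))
    (hy : ∀ i j, 1 ≤ j → LinearIndependent F
      (fun k : Fin (p i).natDegree => AdjoinRoot.mk (p i) (y i j k)))
    {u : F[X]} (hu : ∀ i, IsCoprime u (p i)) (c : F[X]) (m : ℕ) (i₀ : Fin s) (H : ℕ → ℝ) :
    ∑ a ∈ Finset.range (b ^ ∑ i, (p i).natDegree * m),
      H (digitPrefix φ (p i₀) (y i₀) ((p i₀).natDegree * m) (u * digitPoly b φ a + c)) =
    (b : ℝ) ^ (∑ i ∈ Finset.univ.erase i₀, (p i).natDegree * m) *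
      ∑ x ∈ Finset.range (b ^ ((p i₀).natDegree * m)), H x := by
  have h := sum_box_mul_digitPrefix hφ hdeg hcop hy hu c m (fun i => le_refl _) i₀ H
  push_cast at h
  rw [Finset.prod_pow_eq_pow_sum] at h
  rw [← h]
  refine Finset.sum_congr rfl fun a _ => ?_
  rw [Finset.prod_eq_one, one_mul]
  intro i _
  rw [if_pos]
  exact prefixNat_lt _ _

/-- The mean error that is made when the coordinates of the points are truncated. -/
theorem sum_abs_indicator_sub_le (hφ : φ 0 = 0) (hdeg : ∀ i, 1 ≤ (p i).natDegree)
    (hcop : ∀ i i', i ≠ i' → IsCoprime (p i) (p i')) (hX : ∀ i, IsCoprime X (p i))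
    (hy : ∀ i j, 1 ≤ j → LinearIndependent F
      (fun k : Fin (p i).natDegree => AdjoinRoot.mk (p i) (y i j k)))
    {γ : Fin s → ℝ} (hγ : ∀ i, 0 ≤ γ i) (m k : ℕ) {l : ℕ} (hl : l < b ^ k) :
    (b : ℝ) ^ m * ∑ a ∈ Finset.range (b ^ ∑ i, (p i).natDegree * m),
      |(anchoredBox γ).indicator (fun _ => (1 : ℝ))
          (generalizedNiederreiterSequence b φ p y (a * b ^ k + l)) -
        ∏ i, if digitPrefix φ (p i) (y i) ((p i).natDegree * m)
            (X ^ k * digitPoly b φ a + digitPoly b φ l) <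
          ⌊γ i * (b : ℝ) ^ ((p i).natDegree * m)⌋₊ then (1 : ℝ) else 0| ≤
      2 * s * (b : ℝ) ^ ∑ i, (p i).natDegree * m := by
  classical
  have hb1 : (1 : ℝ) ≤ b := by exact_mod_cast (one_lt_of_equiv_field φ).le
  have hb0 : (0 : ℝ) < b := by linarith
  set g : Fin s → ℕ := fun i => ⌊γ i * (b : ℝ) ^ ((p i).natDegree * m)⌋₊ with hg
  set v : ℕ → Fin s → ℕ := fun a i => digitPrefix φ (p i) (y i) ((p i).natDegree * m)
    (X ^ k * digitPoly b φ a + digitPoly b φ l) with hv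
  have hpt : ∀ a, |(anchoredBox γ).indicator (fun _ => (1 : ℝ))
          (generalizedNiederreiterSequence b φ p y (a * b ^ k + l)) -
        ∏ i, if v a i < g i then (1 : ℝ) else 0| ≤
      ∑ i, if v a i + 1 = g i ∨ v a i = g i then (1 : ℝ) else 0 := by
    intro a
    rw [anchoredBox_indicator γ fun i => by
      rw [generalizedNiederreiterSequence_apply]; exact Real.ofDigits_nonneg _]
    apply abs_prod_ite_sub_prod_ite_le
    intro i hi
    push Not at hi
    rw [generalizedNiederreiterSequence_apply]
    simp only [digitPoly_mul_pow_add hφ _ _ hl]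
    exact ofDigits_lt_iff_of_ne _ _ (hγ i) hi.1 hi.2
  have hi : ∀ i, (b : ℝ) ^ m * ∑ a ∈ Finset.range (b ^ ∑ i, (p i).natDegree * m),
      (if v a i + 1 = g i ∨ v a i = g i then (1 : ℝ) else 0) ≤
        2 * (b : ℝ) ^ ∑ i, (p i).natDegree * m := by
    intro i
    have h1 := sum_comp_digitPrefix hφ hdeg hcop hy (u := X ^ k) (fun i => (hX i).pow_left)
      (digitPoly b φ l) m i (fun x => if x + 1 = g i ∨ x = g i then (1 : ℝ) else 0)
    -- At most two of the b^(e_i m) prefixes in coordinate i are bad, and each prefix is taken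
    -- equally often.
    rw [h1, Finset.sum_boole, ← Finset.add_sum_erase _ _ (Finset.mem_univ i), pow_add]
    have h2 : ((Finset.range (b ^ ((p i).natDegree * m))).filter
        fun x => x + 1 = g i ∨ x = g i).card ≤ 2 := by
      refine (Finset.card_le_card (t := {g i - 1, g i}) ?_).trans Finset.card_le_two
      intro x hx
      have := (Finset.mem_filter.1 hx).2
      simp only [Finset.mem_insert, Finset.mem_singleton]
      omega
    have h2' : (((Finset.range (b ^ ((p i).natDegree * m))).filter
        fun x => x + 1 = g i ∨ x = g i).card : ℝ) ≤ 2 := by exact_mod_cast h2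
    have h3 : (b : ℝ) ^ m ≤ (b : ℝ) ^ ((p i).natDegree * m) :=
      pow_le_pow_right₀ hb1 (Nat.le_mul_of_pos_left m (hdeg i))
    calc _ ≤ (b : ℝ) ^ ((p i).natDegree * m) *
          ((b : ℝ) ^ (∑ i ∈ Finset.univ.erase i, (p i).natDegree * m) * 2) := by gcongr
      _ = _ := by ring
  calc _ ≤ (b : ℝ) ^ m * ∑ a ∈ Finset.range (b ^ ∑ i, (p i).natDegree * m),
        ∑ i, (if v a i + 1 = g i ∨ v a i = g i then (1 : ℝ) else 0) := by
        gcongr with a _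
        exact hpt a
    _ = ∑ i, (b : ℝ) ^ m * ∑ a ∈ Finset.range (b ^ ∑ i, (p i).natDegree * m),
        (if v a i + 1 = g i ∨ v a i = g i then (1 : ℝ) else 0) := by
        rw [Finset.sum_comm, Finset.mul_sum]
    _ ≤ ∑ i : Fin s, 2 * (b : ℝ) ^ ∑ i, (p i).natDegree * m := Finset.sum_le_sum fun i _ => hi i
    _ = _ := by
        simp only [Finset.sum_const, Finset.card_univ, Fintype.card_fin, nsmul_eq_mul]
        ring

end BoxSums

/-! ### The second-moment argument -/

/-- If a function, bounded by `K` up to a constant and a small error, correlates with each of `T²`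
orthogonal functions of mean zero, then `K` is large. -/
theorem le_of_orthogonal_correlations {I : Finset ℕ} {T : ℕ} (hT : 0 < T) {R : ℕ → ℕ → ℝ}
    {S U : ℕ → ℝ} {C K c : ℝ} (hR : ∀ t a, |R t a| ≤ 1)
    (horth : ∀ t t', t < t' → t' < T ^ 2 → ∑ a ∈ I, R t a * R t' a = 0)
    (hmean : ∀ t < T ^ 2, ∑ a ∈ I, R t a = 0) (hS : ∀ a, |S a| ≤ K)
    (hU : ∀ t < T ^ 2, c * I.card ≤ ∑ a ∈ I, U a * R t a)
    (hE : (T : ℝ) ^ 2 * ∑ a ∈ I, |U a - (S a + C)| ≤ I.card) :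
    c * (T : ℝ) ^ 2 * I.card ≤ (K * T + 1) * I.card := by
  have hT0 : (0 : ℝ) < T := by exact_mod_cast hT
  have hK : 0 ≤ K := (abs_nonneg _).trans (hS 0)
  set P : ℕ → ℝ := fun a => ∑ t ∈ Finset.range (T ^ 2), R t a with hP
  have hPabs : ∀ a, |P a| ≤ (T : ℝ) ^ 2 := by
    intro a
    calc |P a| ≤ ∑ t ∈ Finset.range (T ^ 2), |R t a| := Finset.abs_sum_le_sum_abs _ _
      _ ≤ ∑ t ∈ Finset.range (T ^ 2), 1 := Finset.sum_le_sum fun t _ => hR t a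
      _ = _ := by simp
  have hPmean : ∑ a ∈ I, P a = 0 := by
    rw [hP, Finset.sum_comm]
    exact Finset.sum_eq_zero fun t ht => hmean t (Finset.mem_range.1 ht)
  have hPsq : ∑ a ∈ I, P a ^ 2 ≤ (T : ℝ) ^ 2 * I.card := by
    have h1 : ∑ a ∈ I, P a ^ 2 = ∑ t ∈ Finset.range (T ^ 2), ∑ t' ∈ Finset.range (T ^ 2),
        ∑ a ∈ I, R t a * R t' a := by
      simp only [hP, sq, Finset.sum_mul_sum]
      rw [Finset.sum_comm]
      exact Finset.sum_congr rfl fun _ _ => Finset.sum_comm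
    have h2 : ∀ t ∈ Finset.range (T ^ 2), ∑ t' ∈ Finset.range (T ^ 2),
        ∑ a ∈ I, R t a * R t' a ≤ I.card := by
      intro t ht
      rw [Finset.sum_eq_single t]
      · calc ∑ a ∈ I, R t a * R t a ≤ ∑ a ∈ I, 1 := Finset.sum_le_sum fun a _ => by
              rw [← abs_mul_abs_self]
              exact mul_le_one₀ (hR t a) (abs_nonneg _) (hR t a)
          _ = _ := by simp
      · intro t' ht' hne
        rcases lt_or_gt_of_ne hne with h | h
        · rw [← horth t' t h (Finset.mem_range.1 ht)]
          exact Finset.sum_congr rfl fun _ _ => mul_comm _ _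
        · exact horth t t' h (Finset.mem_range.1 ht')
      · exact fun h => absurd ht h
    rw [h1]
    refine (Finset.sum_le_sum h2).trans (le_of_eq ?_)
    simp
  have hUP : c * (T : ℝ) ^ 2 * I.card ≤ ∑ a ∈ I, U a * P a := by
    have h1 : ∑ a ∈ I, U a * P a = ∑ t ∈ Finset.range (T ^ 2), ∑ a ∈ I, U a * R t a := by
      rw [Finset.sum_comm]
      exact Finset.sum_congr rfl fun a _ => by rw [hP, Finset.mul_sum]
    have h2 := Finset.sum_le_sum fun t (ht : t ∈ Finset.range (T ^ 2)) =>
      hU t (Finset.mem_range.1 ht)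
    rw [h1]
    refine le_trans (le_of_eq ?_) h2
    simp only [Finset.sum_const, Finset.card_range, nsmul_eq_mul]
    push_cast
    ring
  -- Weighted Cauchy–Schwarz; as the mean of P² is at most T², the weight T balances the two terms.
  have hSP : ∀ a, S a * P a ≤ K / (2 * T) * P a ^ 2 + K * T / 2 := by
    intro a
    have h1 : S a * P a ≤ K * |P a| := by
      calc S a * P a ≤ |S a * P a| := le_abs_self _
        _ = |S a| * |P a| := abs_mul _ _
        _ ≤ K * |P a| := by gcongr; exact hS a
    have h2 : |P a| ≤ P a ^ 2 / (2 * T) + T / 2 := by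
      rw [← sq_abs (P a), div_add_div _ _ (by positivity) two_ne_zero, le_div_iff₀ (by positivity)]
      nlinarith [sq_nonneg (|P a| - T)]
    calc S a * P a ≤ K * (P a ^ 2 / (2 * T) + T / 2) := h1.trans (by gcongr)
      _ = _ := by ring
  have hEP : ∑ a ∈ I, (U a - (S a + C)) * P a ≤ I.card := by
    refine le_trans (Finset.sum_le_sum fun a _ => ?_) ((Finset.mul_sum I _ _).symm.le.trans hE)
    calc (U a - (S a + C)) * P a ≤ |(U a - (S a + C)) * P a| := le_abs_self _
      _ = |P a| * |U a - (S a + C)| := by rw [abs_mul, mul_comm]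
      _ ≤ _ := by gcongr; exact hPabs a
  have hsplit : ∑ a ∈ I, U a * P a =
      ∑ a ∈ I, S a * P a + ∑ a ∈ I, (U a - (S a + C)) * P a := by
    have h1 : ∑ a ∈ I, C * P a = 0 := by rw [← Finset.mul_sum, hPmean, mul_zero]
    rw [← add_zero (∑ a ∈ I, U a * P a), ← h1, ← Finset.sum_add_distrib, ← Finset.sum_add_distrib]
    rw [← sub_eq_zero, ← Finset.sum_sub_distrib]
    have h2 : ∀ a, U a * P a + C * P a - (S a * P a + (U a - (S a + C)) * P a) = 2 * (C * P a) :=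
      fun a => by ring
    rw [Finset.sum_congr rfl fun a _ => h2 a, ← Finset.mul_sum, h1, mul_zero]
  have hSsum : ∑ a ∈ I, S a * P a ≤ K * T * I.card := by
    calc ∑ a ∈ I, S a * P a ≤ ∑ a ∈ I, (K / (2 * T) * P a ^ 2 + K * T / 2) :=
          Finset.sum_le_sum fun a _ => hSP a
      _ = K / (2 * T) * ∑ a ∈ I, P a ^ 2 + K * T / 2 * I.card := by
          rw [Finset.sum_add_distrib, ← Finset.mul_sum]
          simp only [Finset.sum_const, nsmul_eq_mul]
          ring
      _ ≤ K / (2 * T) * ((T : ℝ) ^ 2 * I.card) + K * T / 2 * I.card := by gcongr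
      _ = K * T * I.card := by field_simp; ring
  linarith

open Filter in
theorem exists_truncation_bounds {b s : ℕ} (hb : 1 < b) {γ : Fin s → ℝ} (hγ : ∀ i, 0 < γ i) (J : ℕ)
    (N : ℝ) : ∃ m : ℕ, J ≤ m ∧ N ≤ (b : ℝ) ^ m ∧ ∀ i, 2 ≤ γ i * (b : ℝ) ^ m := by
  have hb1 : (1 : ℝ) < b := by exact_mod_cast hb
  have ht := tendsto_pow_atTop_atTop_of_one_lt hb1
  have h1 : ∀ᶠ m in atTop, ∀ i, 2 ≤ γ i * (b : ℝ) ^ m :=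
    eventually_all.2 fun i => (ht.const_mul_atTop (hγ i)).eventually_ge_atTop 2
  obtain ⟨m, hm⟩ := ((eventually_ge_atTop J).and ((ht.eventually_ge_atTop N).and h1)).exists
  exact ⟨m, hm⟩

open Filter in
theorem exists_sparse_fract_mem {b : ℕ} (hb : 1 < b) {γ : ℝ}
    (h : ∀ J : ℕ, Int.fract (γ * (b : ℝ) ^ J) ≠ 0) (e : ℕ) :
    ∃ j : ℕ → ℕ, (∀ t, j t + e ≤ j (t + 1)) ∧ ∀ t, 1 / (2 * b : ℝ) ≤ Int.fract (γ * (b : ℝ) ^ j t) ∧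
      Int.fract (γ * (b : ℝ) ^ j t) ≤ 1 - 1 / (2 * b : ℝ) := by
  obtain ⟨ψ, hψ, hP⟩ := extraction_of_frequently_atTop (frequently_atTop.2
    fun J₀ => (exists_fract_mul_pow_mem hb h J₀))
  refine ⟨fun t => ψ (e * t), fun t => ?_, fun t => hP _⟩
  have := hψ.add_le_nat e (e * t)
  simp only
  rw [mul_add, mul_one, add_comm (e * t)]
  omega

/-! ### Bounded remainder forces finite expansions -/

section Unbounded
open Polynomial
variable {F : Type*} [Field F] {b : ℕ} [NeZero b] {φ : Fin b ≃ F} {s : ℕ} {p : Fin s → F[X]}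
  {y : Fin s → ℕ → ℕ → F[X]}

theorem exists_fract_ne_zero_of_not_hasFiniteExpansions {γ : Fin s → ℝ}
    (hγ : ∀ i, γ i ∈ Set.Ioo (0 : ℝ) 1) (h : ¬ HasFiniteExpansions b γ) :
    ∃ i, ∀ J : ℕ, Int.fract (γ i * (b : ℝ) ^ J) ≠ 0 := by
  by_contra! hcon
  refine h (hasFiniteExpansions_of_mul_pow_eq_natCast fun i => ?_)
  obtain ⟨J, hJ⟩ := hcon i
  refine ⟨J, ⌊γ i * (b : ℝ) ^ J⌋₊, ?_⟩
  have h0 : 0 ≤ γ i * (b : ℝ) ^ J := mul_nonneg (hγ i).1.le (by positivity)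
  rw [natCast_floor_eq_intCast_floor h0]
  have := Int.floor_add_fract (γ i * (b : ℝ) ^ J)
  rw [hJ, add_zero] at this
  exact this.symm

theorem hasFiniteExpansions_of_isBoundedRemainderSet (hφ : φ 0 = 0)
    (hdeg : ∀ i, 1 ≤ (p i).natDegree) (hcop : ∀ i i', i ≠ i' → IsCoprime (p i) (p i'))
    (hX : ∀ i, IsCoprime X (p i))
    (hy : ∀ i j, 1 ≤ j → LinearIndependent F
      (fun k : Fin (p i).natDegree => AdjoinRoot.mk (p i) (y i j k)))
    {γ : Fin s → ℝ} (hγ : ∀ i, γ i ∈ Set.Ioo (0 : ℝ) 1)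
    (hbdd : IsBoundedRemainderSet (anchoredBox γ) (generalizedNiederreiterSequence b φ p y)) :
    HasFiniteExpansions b γ := by
  by_contra hinf
  have : Fintype F := Fintype.ofEquiv _ φ
  have hb := one_lt_of_equiv_field φ
  have hb1 : (1 : ℝ) < b := by exact_mod_cast hb
  have hb0 : (0 : ℝ) < b := by linarith
  obtain ⟨K, hK⟩ := hbdd
  obtain ⟨i₀, hi₀⟩ := exists_fract_ne_zero_of_not_hasFiniteExpansions hγ hinf
  set e := (p i₀).natDegree with he
  -- Each d t differs from j t by less than e, so spacing 2e leaves the d t at least 2 apart.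
  obtain ⟨j, hj, hjf⟩ := exists_sparse_fract_mem hb hi₀ (2 * e)
  have hjmono : Monotone j := monotone_nat_of_le_succ fun t => (Nat.le_add_right _ _).trans (hj t)
  choose w d hjd hdj hw hw0 hwrep using
    fun t => exists_residuePairing_of_digitFunctional (hdeg i₀) (hy i₀) (j t)
  have hd : ∀ t, d t + 2 ≤ d (t + 1) := fun t => by
    have h1 := hj t
    have h2 := hjd (t + 1)
    have h3 := hdj t
    omega
  choose Λ hΛ using fun t => exists_residuePairing_eq_digitPrefix φ (hwrep t)
  -- The product bounds the loss from the floors in the other coordinates, 1/(2 b^e) compares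
  -- b^(u+d)/2 with b^W, and (1/(4b))² is the variance bound.
  set c : ℝ := (∏ i ∈ Finset.univ.erase i₀, γ i / 2) * (1 / (2 * (b : ℝ) ^ e)) *
    (1 / (4 * b : ℝ)) ^ 2 with hc
  have hc0 : 0 < c := by
    have : 0 < ∏ i ∈ Finset.univ.erase i₀, γ i / 2 :=
      Finset.prod_pos fun i _ => half_pos (hγ i).1
    positivity
  obtain ⟨T, hT⟩ := exists_nat_gt (max 1 ((2 * K + 1) / c))
  have hT1 : (1 : ℝ) < T := (le_max_left _ _).trans_lt hT
  have hT2 : 2 * K + 1 < c * T := by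
    have := (le_max_right _ _).trans_lt hT
    rwa [div_lt_iff₀ hc0, mul_comm (T : ℝ)] at this
  have hTpos : 0 < T := by
    have : (0 : ℝ) < T := by linarith
    exact_mod_cast this
  set L := ∑ t ∈ Finset.range (T ^ 2), b ^ d t with hL
  have hLlt : L < b ^ L := Nat.lt_pow_self hb
  -- The three demands on m give u t ≥ 2, a negligible total truncation error, and floors g i of at
  -- least half their argument.
  obtain ⟨m, hm1, hm2, hm3⟩ := exists_truncation_bounds hb (fun i => (hγ i).1) (j (T ^ 2) + 3)
    ((T : ℝ) ^ 2 * L * (2 * s))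
  set D := ∑ i, (p i).natDegree * m with hD
  set g : Fin s → ℕ := fun i => ⌊γ i * (b : ℝ) ^ ((p i).natDegree * m)⌋₊ with hg
  have hgle : ∀ i, g i ≤ b ^ ((p i).natDegree * m) := by
    intro i
    apply Nat.floor_le_of_le
    push_cast
    exact mul_le_of_le_one_left (by positivity) (hγ i).2.le
  have hgge : ∀ i, γ i / 2 * (b : ℝ) ^ ((p i).natDegree * m) ≤ g i := by
    intro i
    have h1 := Nat.lt_floor_add_one (γ i * (b : ℝ) ^ ((p i).natDegree * m))
    have h2 : (b : ℝ) ^ m ≤ (b : ℝ) ^ ((p i).natDegree * m) :=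
      pow_le_pow_right₀ hb1.le (Nat.le_mul_of_pos_left m (hdeg i))
    have h3 := mul_le_mul_of_nonneg_left h2 (hγ i).1.le
    have h4 := hm3 i
    linarith
  set W := e * m with hW
  have hmW : m ≤ W := Nat.le_mul_of_pos_left m (hdeg i₀)
  set u : ℕ → ℕ := fun t => W - j t - 1 with hu
  have hjW : ∀ t < T ^ 2, j t + u t + 1 = W ∧ 2 ≤ u t := by
    intro t ht
    have := hjmono ht.le
    simp only [hu]
    omega
  set Λ' : ℕ → ℕ → F := fun t a => residuePairing (w t) (X ^ (d t + 1) * digitPoly b φ a) with hΛ'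
  have hρ : ∀ t, ∃ ρ : F → ℝ, (∀ z, |ρ z| ≤ 1) ∧ ∑ z, ρ z = 0 ∧ (t < T ^ 2 →
      (b : ℝ) ^ u t * ((b : ℝ) ^ d t / 2) * (1 / (4 * b : ℝ)) ^ 2 ≤
        ∑ l ∈ Finset.range L, ∑ x ∈ Finset.range (g i₀),
          ρ (Λ t (x / b ^ (u t + 1)) + φ (natDigit b x (u t)) -
            (Λ' t (l / b ^ (d t + 1)) + φ (natDigit b l (d t)) *
              (w t).coeff ((d t : ℤ) + 1)))) := by
    intro t
    by_cases ht : t < T ^ 2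
    · obtain ⟨rest, hr1, hr2⟩ := sum_pow_mod hb hd ht
      obtain ⟨h1, h2⟩ := hjW t ht
      have h3 := mod_div_pow_mem_Icc hb (hγ i₀).1.le h2 (hjf t).1 (hjf t).2
      rw [h1] at h3
      obtain ⟨ρ, hρ1, hρ2, hρ3⟩ := exists_correlating_function hφ (Λ t) (Λ' t) (hw t) (g := g i₀)
        (by positivity) h3.1 h3.2 hr1 hr2
      exact ⟨ρ, hρ1, hρ2, fun _ => hρ3⟩
    -- A dummy value, needed only to choose ρ for all t.
    · exact ⟨0, by simp, by simp, fun h => absurd h ht⟩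
  choose ρ hρ1 hρ2 hρ3 using hρ
  set R : ℕ → ℕ → ℝ := fun t a => ρ t (residuePairing (w t) (X ^ L * digitPoly b φ a)) with hR
  set v : F[X] → ℕ → ℕ := fun f a => digitPrefix φ (p i₀) (y i₀) W (X ^ L * digitPoly b φ a + f)
    with hv
  have hcopX : ∀ i, IsCoprime (X ^ L) (p i) := fun i => (hX i).pow_left
  have hrep : ∀ t < T ^ 2, ∀ f, residuePairing (w t) f =
      Λ t (digitPrefix φ (p i₀) (y i₀) W f / b ^ (u t + 1)) +
        φ (natDigit b (digitPrefix φ (p i₀) (y i₀) W f) (u t)) := by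
    intro t ht f
    have := hΛ t (u t) f
    rwa [(hjW t ht).1] at this
  have hRv : ∀ t < T ^ 2, ∀ a, R t a =
      ρ t (Λ t (v 0 a / b ^ (u t + 1)) + φ (natDigit b (v 0 a) (u t))) := by
    intro t ht a
    simp only [hR, hv, add_zero]
    rw [hrep t ht]
  have hsumW : ∀ t < T ^ 2, ∀ h : ℕ → ℝ, ∑ a ∈ Finset.range (b ^ D), h (v 0 a / b ^ (u t + 1)) *
      R t a = 0 := by
    intro t ht h
    rw [Finset.sum_congr rfl fun a _ => by rw [hRv t ht a]]
    have h1 := sum_comp_digitPrefix hφ hdeg hcop hy hcopX 0 m i₀ (fun x => h (x / b ^ (u t + 1)) *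
      ρ t (Λ t (x / b ^ (u t + 1)) + φ (natDigit b x (u t))))
    refine h1.trans ?_
    rw [sum_range_block (hρ2 t) φ h (Λ t), Nat.mod_eq_zero_of_dvd]
    · simp
    · apply pow_dvd_pow
      change u t + 1 ≤ W
      have := (hjW t ht).1
      omega
  set S : ℕ → ℝ := fun a => ∑ l ∈ Finset.range L, ((anchoredBox γ).indicator (fun _ => (1 : ℝ))
    (generalizedNiederreiterSequence b φ p y (a * b ^ L + l)) -
      (MeasureTheory.volume : MeasureTheory.Measure _).real (anchoredBox γ)) with hS
  have hSK : ∀ a, |S a| ≤ 2 * K := by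
    intro a
    have h1 : S a = discrepancyFunction (anchoredBox γ)
        (generalizedNiederreiterSequence b φ p y) (a * b ^ L + L) -
        discrepancyFunction (anchoredBox γ)
          (generalizedNiederreiterSequence b φ p y) (a * b ^ L) := by
      rw [discrepancyFunction, discrepancyFunction, Finset.sum_range_add, add_sub_cancel_left]
    rw [h1, two_mul]
    exact (abs_sub _ _).trans (add_le_add (hK _) (hK _))
  set U : ℕ → ℝ := fun a => ∑ l ∈ Finset.range L, ∏ i,
    if digitPrefix φ (p i) (y i) ((p i).natDegree * m)
      (X ^ L * digitPoly b φ a + digitPoly b φ l) < g i then (1 : ℝ) else 0 with hU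
  have hmain := le_of_orthogonal_correlations (I := Finset.range (b ^ D)) hTpos (R := R) (S := S)
    (U := U) (K := 2 * K) (c := c)
    (C := L * (MeasureTheory.volume : MeasureTheory.Measure _).real (anchoredBox γ))
    (fun t a => hρ1 t _) ?_ ?_ hSK ?_ ?_
  · have hcard : (0 : ℝ) < (Finset.range (b ^ D)).card := by
      rw [Finset.card_range]
      exact_mod_cast Nat.pow_pos (NeZero.pos b)
    have h1 := le_of_mul_le_mul_right hmain hcard
    nlinarith
  -- As j t < j t', the function R t depends only on digits before position j t', that is on v /
  -- b^(u t' + 1). On each fibre of this quotient R t' has sum zero.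
  · intro t t' htt ht'
    have ht : t < T ^ 2 := htt.trans ht'
    obtain ⟨r, hr⟩ : ∃ r, u t = u t' + 1 + r := by
      have h1 : j t + 2 * e ≤ j t' := (hj t).trans (hjmono htt)
      have h2 := (hjW t ht).1
      have h3 := (hjW t' ht').1
      have h4 := hdeg i₀
      exact ⟨u t - u t' - 1, by omega⟩
    rw [← hsumW t' ht' fun z => ρ t (Λ t (z / b ^ (r + 1)) + φ (natDigit b z r))]
    refine Finset.sum_congr rfl fun a _ => ?_
    rw [hRv t ht, hr, natDigit_div_pow, Nat.div_div_eq_div_mul, ← pow_add]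
    rfl
  · intro t ht
    have := hsumW t ht fun _ => 1
    simpa only [one_mul] using this
  · intro t ht
    -- Linearity gives ⟨w, X^L f_a⟩ = ⟨w, X^L f_a + f_l⟩ - ⟨w, f_l⟩. The first term is read from the
    -- prefix of the point, which is equidistributed, and the second from the digits of l.
    have h1 : ∀ l, ∑ a ∈ Finset.range (b ^ D), (∏ i,
        if digitPrefix φ (p i) (y i) ((p i).natDegree * m)
          (X ^ L * digitPoly b φ a + digitPoly b φ l) < g i then (1 : ℝ) else 0) * R t a =
        (∏ i ∈ Finset.univ.erase i₀, (g i : ℝ)) * ∑ x ∈ Finset.range (g i₀),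
          ρ t (Λ t (x / b ^ (u t + 1)) + φ (natDigit b x (u t)) -
            (Λ' t (l / b ^ (d t + 1)) + φ (natDigit b l (d t)) *
              (w t).coeff ((d t : ℤ) + 1))) := by
      intro l
      rw [← sum_box_mul_digitPrefix hφ hdeg hcop hy hcopX (digitPoly b φ l) m hgle i₀]
      refine Finset.sum_congr rfl fun a _ => ?_
      congr 1
      simp only [hR]
      congr 1
      rw [← residuePairing_digitPoly_eq hφ (hw0 t), ← hrep t ht, map_add, add_sub_cancel_right]
    have h2 : ∑ a ∈ Finset.range (b ^ D), U a * R t a =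
        (∏ i ∈ Finset.univ.erase i₀, (g i : ℝ)) * ∑ l ∈ Finset.range L,
          ∑ x ∈ Finset.range (g i₀), ρ t (Λ t (x / b ^ (u t + 1)) + φ (natDigit b x (u t)) -
            (Λ' t (l / b ^ (d t + 1)) + φ (natDigit b l (d t)) *
              (w t).coeff ((d t : ℤ) + 1))) := by
      simp only [hU, Finset.sum_mul]
      rw [Finset.sum_comm, Finset.mul_sum]
      exact Finset.sum_congr rfl fun l _ => h1 l
    rw [h2, Finset.card_range]
    have h3 : (∏ i ∈ Finset.univ.erase i₀, γ i / 2) *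
        (b : ℝ) ^ (∑ i ∈ Finset.univ.erase i₀, (p i).natDegree * m) ≤
          ∏ i ∈ Finset.univ.erase i₀, (g i : ℝ) := by
      rw [← Finset.prod_pow_eq_pow_sum, ← Finset.prod_mul_distrib]
      exact Finset.prod_le_prod (fun i _ => mul_nonneg (half_pos (hγ i).1).le (by positivity))
        fun i _ => hgge i
    have h4 : (b : ℝ) ^ W * (1 / (2 * (b : ℝ) ^ e)) ≤ (b : ℝ) ^ u t * ((b : ℝ) ^ d t / 2) := by
      have h5 : (b : ℝ) ^ W ≤ (b : ℝ) ^ (u t + d t + e) := by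
        apply pow_le_pow_right₀ hb1.le
        have := (hjW t ht).1
        have := hjd t
        omega
      rw [pow_add, pow_add] at h5
      rw [mul_one_div, div_le_iff₀ (by positivity)]
      linarith
    have hDsplit : (b : ℝ) ^ D = (b : ℝ) ^ W *
        (b : ℝ) ^ (∑ i ∈ Finset.univ.erase i₀, (p i).natDegree * m) := by
      rw [← pow_add, hD, ← Finset.add_sum_erase _ _ (Finset.mem_univ i₀)]
    have hprod0 : 0 ≤ ∏ i ∈ Finset.univ.erase i₀, γ i / 2 :=
      Finset.prod_nonneg fun i _ => (half_pos (hγ i).1).le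
    push_cast
    calc c * (b : ℝ) ^ D = ((∏ i ∈ Finset.univ.erase i₀, γ i / 2) *
          (b : ℝ) ^ (∑ i ∈ Finset.univ.erase i₀, (p i).natDegree * m)) *
          ((b : ℝ) ^ W * (1 / (2 * (b : ℝ) ^ e)) * (1 / (4 * b : ℝ)) ^ 2) := by
          rw [hc, hDsplit]
          ring
      _ ≤ (∏ i ∈ Finset.univ.erase i₀, (g i : ℝ)) *
          ((b : ℝ) ^ u t * ((b : ℝ) ^ d t / 2) * (1 / (4 * b : ℝ)) ^ 2) := by
          gcongr
      _ ≤ _ := mul_le_mul_of_nonneg_left (hρ3 t ht)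
          (Finset.prod_nonneg fun i _ => Nat.cast_nonneg _)
  · have h1 : ∀ a, |U a - (S a + L * (MeasureTheory.volume : MeasureTheory.Measure _).real
        (anchoredBox γ))| ≤ ∑ l ∈ Finset.range L, |(anchoredBox γ).indicator (fun _ => (1 : ℝ))
          (generalizedNiederreiterSequence b φ p y (a * b ^ L + l)) -
        ∏ i, if digitPrefix φ (p i) (y i) ((p i).natDegree * m)
            (X ^ L * digitPoly b φ a + digitPoly b φ l) < g i then (1 : ℝ) else 0| := by
      intro a
      rw [abs_sub_comm]
      refine le_trans (le_of_eq ?_) (Finset.abs_sum_le_sum_abs _ _)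
      congr 1
      simp only [hU, hS, Finset.sum_sub_distrib, Finset.sum_const, Finset.card_range, nsmul_eq_mul]
      ring
    have h2 : (b : ℝ) ^ m * ∑ a ∈ Finset.range (b ^ D), |U a - (S a + L *
        (MeasureTheory.volume : MeasureTheory.Measure _).real (anchoredBox γ))| ≤
          L * (2 * s) * (b : ℝ) ^ D := by
      calc _ ≤ (b : ℝ) ^ m * ∑ a ∈ Finset.range (b ^ D), ∑ l ∈ Finset.range L, _ :=
            mul_le_mul_of_nonneg_left (Finset.sum_le_sum fun a _ => h1 a) (by positivity)
        _ ≤ ∑ l ∈ Finset.range L, 2 * s * (b : ℝ) ^ D := by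
            rw [Finset.sum_comm, Finset.mul_sum]
            exact Finset.sum_le_sum fun l hl => sum_abs_indicator_sub_le hφ hdeg hcop hX hy
              (fun i => (hγ i).1.le) m L ((Finset.mem_range.1 hl).trans hLlt)
        _ = _ := by
            simp only [Finset.sum_const, Finset.card_range, nsmul_eq_mul]
            ring
    rw [Finset.card_range]
    push_cast
    have hbm : (0 : ℝ) < (b : ℝ) ^ m := by positivity
    refine le_of_mul_le_mul_left ?_ hbm
    calc _ = (T : ℝ) ^ 2 * ((b : ℝ) ^ m * ∑ a ∈ Finset.range (b ^ D), |U a - (S a + L *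
        (MeasureTheory.volume : MeasureTheory.Measure _).real (anchoredBox γ))|) := by ring
      _ ≤ (T : ℝ) ^ 2 * (L * (2 * s) * (b : ℝ) ^ D) := by gcongr
      _ = ((T : ℝ) ^ 2 * L * (2 * s)) * (b : ℝ) ^ D := by ring
      _ ≤ _ := by gcongr

end Unbounded

theorem theorem1 {F : Type*} [Field F] (b : ℕ) [NeZero b]
    -- `φ` makes `F` a field with `b` elements; it is the bijection from the digits to `F`
    (φ : Fin b ≃ F) (hφ : φ 0 = 0)
    (s : ℕ) (p : Fin s → Polynomial F)
    (hdeg : ∀ i, 1 ≤ (p i).natDegree)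
    (hcop : ∀ i i', i ≠ i' → IsCoprime (p i) (p i'))
    (hX : ∀ i, IsCoprime Polynomial.X (p i))
    (y : Fin s → ℕ → ℕ → Polynomial F)
    (hy : ∀ i j, 1 ≤ j → LinearIndependent F
      (fun k : Fin (p i).natDegree => AdjoinRoot.mk (p i) (y i j k)))
    (γ : Fin s → ℝ) (hγ : ∀ i, γ i ∈ Set.Ioo (0 : ℝ) 1) :
    IsBoundedRemainderSet (anchoredBox γ) (generalizedNiederreiterSequence b φ p y) ↔
      HasFiniteExpansions b γ := by
  exact ⟨hasFiniteExpansions_of_isBoundedRemainderSet hφ hdeg hcop hX hy hγ,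
    isBoundedRemainderSet_of_hasFiniteExpansions hφ hdeg hcop hy hγ⟩
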